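/- Let $2^{<\omega}$ be the set of finite binary strings and $2^\omega$ the set of infinite binary sequences. For $\sigma\in 2^{<\omega}$ let $[\sigma]\subseteq 2^\omega$ be the set of all infinite sequences extending $\sigma$, and for $W\subseteq 2^{<\omega}$ let $[W]^{\preceq}=\bigcup_{\sigma\in W}[\sigma]$. The \emph{optimal covering} of $S\subseteq 2^{<\omega}$ is $$O_S=\{\sigma\in 2^{<\omega} : [\sigma]\subseteq [S]^{\preceq}\text{ and there is no proper prefix }\tau\text{ of }\sigma\text{ with }[\tau]\subseteq [S]^{\preceq}\}.$$ Let $\mathfrak A$ be the family of all sets $O$ that are optimal coverings of sets $S\subseteq 2^{<\omega}$ and are finite of odd cardinality. An \emph{effective numbering} of a family $\mathcal F$ of subsets of $2^\omega$, as a family of $\Sigma^0_1$ classes, is a map $\psi$ from $\omega$ onto $\mathcal F$ such that the relation $X\in\psi(e)$ is $\Sigma^0_1$ on $2^\omega\times\omega$, that is, there is a computably enumerable set $W\subseteq 2^{<\omega}\times\omega$ such that for all $X$ and $e$: $X\in\psi(e)$ if and only if $(X\upharpoonright n,e)\in W$ for some $n$. If $\psi$ is moreover injective, it is called a \emph{Friedberg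 numbering} of $\mathcal F$. A family of $\Sigma^0_1$ classes is \emph{effectively enumerable} if it has an effective numbering. \textbf{Theorem.} Every effectively enumerable family $\mathcal F$ of $\Sigma^0_1$ classes with $\mathcal F\supseteq\{[O]^{\preceq} : O\in\mathfrak A\}$ has a Friedberg numbering. -/

import Mathlib

namespace CantorNumbering

/-- The initial segment `⟨X 0, …, X (n - 1)⟩` of the infinite binary sequence `X`. -/
def initSeg (X : ℕ → Bool) (n : ℕ) : List Bool :=
  (List.range n).map X

/-- The cone of all infinite binary sequences extending the finite string `σ`. -/
def cone (σ : List Bool) : Set (ℕ → Bool) :=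
  {X | initSeg X σ.length = σ}

/-- The open class generated by a set `W` of strings: the union of the cones of its members. -/
def openClass (W : Set (List Bool)) : Set (ℕ → Bool) :=
  ⋃ σ ∈ W, cone σ

/-- The optimal covering of `S`: the prefix-minimal strings whose cone is contained in the open
class generated by `S`. -/
def optimalCovering (S : Set (List Bool)) : Set (List Bool) :=
  {σ | cone σ ⊆ openClass S ∧ ¬ ∃ τ, τ <+: σ ∧ τ ≠ σ ∧ cone τ ⊆ openClass S}

/-- The family of all optimal coverings (of arbitrary sets of strings) that are finite and have
an odd number of elements. -/
def oddOptimalCoverings : Set (Set (List Bool)) :=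
  {O | (∃ S : Set (List Bool), O = optimalCovering S) ∧ O.Finite ∧ Odd O.ncard}

/-- A relation `R` between infinite binary sequences and natural numbers is `Σ⁰₁`: there is a
computably enumerable relation `W` between strings and numbers such that `R X e` holds if and only
if `W` holds of some initial segment of `X` and `e`. -/
def IsSigma01 (R : (ℕ → Bool) → ℕ → Prop) : Prop :=
  ∃ W : List Bool × ℕ → Prop, REPred W ∧ ∀ X e, R X e ↔ ∃ n, W (initSeg X n, e)

/-- `ψ` is an effective numbering of the family `F` of classes: it maps `ℕ` onto `F`, and the
relation `X ∈ ψ e` is `Σ⁰₁`. In particular, every member of `F` is then a `Σ⁰₁` class. -/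
structure IsEffectiveNumbering (ψ : ℕ → Set (ℕ → Bool)) (F : Set (Set (ℕ → Bool))) : Prop where
  range_eq : Set.range ψ = F
  sigma : IsSigma01 fun X e => X ∈ ψ e

/-- A Friedberg numbering of `F` is an injective effective numbering of `F`. -/
structure IsFriedbergNumbering (ψ : ℕ → Set (ℕ → Bool)) (F : Set (Set (ℕ → Bool))) : Prop
    extends IsEffectiveNumbering ψ F where
  injective : Function.Injective ψ

/-- A family of classes is an effectively enumerable family of `Σ⁰₁` classes if it has an
effective numbering. -/
def IsEffectivelyEnumerable (F : Set (Set (ℕ → Bool))) : Prop :=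
  ∃ ψ, IsEffectiveNumbering ψ F

end CantorNumbering

namespace CantorNumbering

/-! Clopen classes are coded by finite lists of strings, preordered by inclusion. An effective
numbering becomes a computable array of increasing sequences `a i` of codes, and by compactness two
of the open classes agree exactly when their sequences are cofinal. Codes with an odd optimal
covering are good. They name members of the family, and infinitely many of them lie between any
clopen `d ⊊ e` (`exists_good_between`). So a value that approximates a class already numbered can be
enlarged to a fresh good class and abandoned there.

Slots are pairs `(i, n)`, where `n` guesses a bound on the evidence that separates `a i` from all
earlier sequences. One slot stays active for each index that is least for its class; every other
slot is eventually inactive. An active slot pursues `a i`: it takes the current value if no smaller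
index shows it and no slot holds it, and otherwise, when required, a fresh good value above the
earlier, strictly smaller stages of `a i`. An inactive slot with a value that is neither bottom nor
good moves to a good one as soon as `a i` leaves room, and freezes.

Every limit is in the family: a clopen limit is good or exhausts `a i`, and any other limit is that
of `a i` itself (`exists_cofinal`). Limits do not repeat: moves never reuse a held value, and a
limit that is not clopen determines its least index and hence its slot (`not_cofinal`). No nonempty
member is missed: jumps of slots `k > i` avoid the current `a i`, so only finitely many slots can
compete by jumping for a clopen class of least index `i`, and once it is free the active slot of `i`
takes it (`exists_slot_of_minimal`). The slots are then renumbered in order of opening, and the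
empty class is added separately. -/

/-- Mutual domination of two elements of a preorder. -/
def Equi {α : Type*} [Preorder α] (c d : α) : Prop := c ≤ d ∧ d ≤ c

/-- Two sequences generate the same ideal. -/
def Cofinal {α : Type*} [Preorder α] (f g : ℕ → α) : Prop :=
  (∀ s, ∃ t, f s ≤ g t) ∧ ∀ s, ∃ t, g s ≤ f t

/-- The sequence generates a principal ideal. -/
def Principal {α : Type*} [Preorder α] (f : ℕ → α) : Prop := ∃ s, ∀ t, f t ≤ f s

section Order
variable {α : Type*} [Preorder α]

theorem Equi.symm {c d : α} (h : Equi c d) : Equi d c := ⟨h.2, h.1⟩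

theorem Equi.trans {c d e : α} (h : Equi c d) (h' : Equi d e) : Equi c e :=
  ⟨h.1.trans h'.1, h'.2.trans h.2⟩

theorem Cofinal.symm {f g : ℕ → α} (h : Cofinal f g) : Cofinal g f := ⟨h.2, h.1⟩

theorem Cofinal.trans {f g h : ℕ → α} (h₁ : Cofinal f g) (h₂ : Cofinal g h) : Cofinal f h := by
  refine ⟨fun s => ?_, fun s => ?_⟩
  · obtain ⟨t, ht⟩ := h₁.1 s
    obtain ⟨u, hu⟩ := h₂.1 t
    exact ⟨u, ht.trans hu⟩
  · obtain ⟨t, ht⟩ := h₂.2 s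
    obtain ⟨u, hu⟩ := h₁.2 t
    exact ⟨u, ht.trans hu⟩

theorem Principal.of_cofinal {f g : ℕ → α} (hf : Principal f) (h : Cofinal f g) :
    Principal g := by
  obtain ⟨s, hs⟩ := hf
  obtain ⟨t, ht⟩ := h.1 s
  refine ⟨t, fun u => ?_⟩
  obtain ⟨r, hr⟩ := h.2 u
  exact hr.trans ((hs r).trans ht)

end Order

/-! ### Approximation systems and the rules by which slots move -/

/-- A sequence `a` of monotone approximations in a preorder, together with a class of `good`
elements that interpolate densely and each of which is approximated by some `a i`. -/
structure ApproxSystem (α : Type*) [Preorder α] where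
  bot : α
  good : α → Prop
  a : ℕ → ℕ → α
  bot_le : ∀ c, bot ≤ c
  a_zero : ∀ i, a i 0 ≤ bot
  mono : ∀ i, Monotone (a i)
  not_good_bot : ∀ c, good c → ¬ c ≤ bot
  dense : ∀ d e : α, d ≤ e → ¬ e ≤ d → ∀ T : List α,
    ∃ c, good c ∧ d ≤ c ∧ c ≤ e ∧ ∀ x ∈ T, ¬ Equi c x
  good_mem : ∀ c, good c → ∃ i, Cofinal (fun _ => c) (a i)
  nontrivial : ∃ e, ¬ e ≤ bot

namespace ApproxSystem
variable {α : Type*} [Preorder α] (S : ApproxSystem α)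

/-- At stage `s`, the first `n` approximations distinguish `a i` from all `a j` with `j < i`. -/
def Sep (i n s : ℕ) : Prop :=
  ∀ j < i, ∃ t < n, ¬ S.a i t ≤ S.a j s ∨ ¬ S.a j t ≤ S.a i s

/-- The slot `k = (i, n)` is active at stage `s`: `n` is least with `Sep i n s`. -/
def Act (k s : ℕ) : Prop :=
  S.Sep k.unpair.1 k.unpair.2 s ∧ ∀ m < k.unpair.2, ¬ S.Sep k.unpair.1 m s

/-- The class of `c` is the value of a slot in `K`. -/
def Held (K : List ℕ) (u : ℕ → α) (c : α) : Prop := ∃ l ∈ K, Equi c (u l)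

/-- The slot `k = (i, n)` may take the value `a i s`. -/
def Exact (K : List ℕ) (u : ℕ → α) (k s : ℕ) : Prop :=
  S.Act k s ∧ (∀ j < k.unpair.1, ¬ Equi (S.a k.unpair.1 s) (S.a j s)) ∧
    ¬ Held K u (S.a k.unpair.1 s)

/-- The slot `k` has to move to a good value. -/
def Jump (u : ℕ → α) (k s : ℕ) : Prop :=
  (S.Act k s ∧ (¬ S.good (u k) ∨ ∃ t < s, u k ≤ S.a k.unpair.1 t ∧
    ¬ S.a k.unpair.1 s ≤ S.a k.unpair.1 t ∧ ¬ S.a k.unpair.1 t ≤ u k)) ∨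
  (¬ S.Act k s ∧ ¬ S.good (u k) ∧ ¬ u k ≤ S.bot)

/-- The value `w` is a suitable good value for the slot `k` at stage `s`. -/
def Interp (K : List ℕ) (u : ℕ → α) (k s : ℕ) (w : α) : Prop :=
  S.good w ∧ u k ≤ w ∧ w ≤ S.a k.unpair.1 s ∧ ¬ w ≤ u k ∧ (∀ j < k, ¬ Equi w (S.a j s)) ∧
    ¬ Held K u w ∧ ∀ t < s, u k ≤ S.a k.unpair.1 t →
      ¬ S.a k.unpair.1 s ≤ S.a k.unpair.1 t → S.a k.unpair.1 t ≤ w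

/-- The slot `k` needs no attention at stage `s`. -/
def Idle (u : ℕ → α) (k s : ℕ) : Prop :=
  ¬ u k ≤ S.a k.unpair.1 s ∨ S.a k.unpair.1 s ≤ u k

/-- The value `w` is the next value of the slot `k`. -/
def Next (K : List ℕ) (u : ℕ → α) (k s : ℕ) (w : α) : Prop :=
  (S.Idle u k s ∧ w = u k) ∨
  (¬ S.Idle u k s ∧
    ((S.Exact K u k s ∧ w = S.a k.unpair.1 s) ∨
     (¬ S.Exact K u k s ∧ ((S.Jump u k s ∧ S.Interp K u k s w) ∨ (¬ S.Jump u k s ∧ w = u k)))))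

theorem exists_interp (K : List ℕ) (u : ℕ → α) (k s : ℕ) (h : ¬ S.Idle u k s) :
    ∃ w, S.Interp K u k s w := by
  classical
  simp only [Idle, not_or, not_not] at h
  set i := k.unpair.1
  obtain ⟨d, hd1, hd2, hd3, hd4⟩ : ∃ d, u k ≤ d ∧ d ≤ S.a i s ∧ ¬ S.a i s ≤ d ∧
      ∀ t < s, u k ≤ S.a i t → ¬ S.a i s ≤ S.a i t → S.a i t ≤ d := by
    by_cases hex : ∃ t < s, u k ≤ S.a i t ∧ ¬ S.a i s ≤ S.a i t
    · let P : ℕ → Prop := fun t => t < s ∧ u k ≤ S.a i t ∧ ¬ S.a i s ≤ S.a i t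
      -- As `a i` increases, the latest stage strictly below the current one dominates all the
      -- others, so interpolating above it suffices.
      obtain ⟨t, ht⟩ := hex
      have hP : P (Nat.findGreatest P s) := Nat.findGreatest_spec (P := P) ht.1.le ht
      refine ⟨S.a i (Nat.findGreatest P s), hP.2.1, S.mono i hP.1.le, hP.2.2, ?_⟩
      intro t' h1 h2 h3
      exact S.mono i (Nat.le_findGreatest (P := P) h1.le ⟨h1, h2, h3⟩)
    · exact ⟨u k, le_rfl, h.1, h.2, fun t h1 h2 h3 => (hex ⟨t, h1, h2, h3⟩).elim⟩
  obtain ⟨c, hc1, hc2, hc3, hc4⟩ := S.dense d (S.a i s) hd2 hd3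
    (u k :: (K.map u ++ (List.range k).map fun j => S.a j s))
  refine ⟨c, hc1, hd1.trans hc2, hc3, ?_, ?_, ?_, fun t h1 h2 h3 => (hd4 t h1 h2 h3).trans hc2⟩
  · exact fun hle => hc4 _ (by simp) ⟨hle, hd1.trans hc2⟩
  · intro j hj
    exact hc4 _ (by
      simp only [List.mem_cons, List.mem_append, List.mem_map, List.mem_range]
      exact Or.inr (Or.inr ⟨j, hj, rfl⟩))
  · rintro ⟨l, hl, he⟩
    exact hc4 _ (by
      simp only [List.mem_cons, List.mem_append, List.mem_map, List.mem_range]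
      exact Or.inr (Or.inl ⟨l, hl, rfl⟩)) he

theorem exists_next (K : List ℕ) (u : ℕ → α) (k s : ℕ) : ∃ w, S.Next K u k s w := by
  classical
  by_cases h : S.Idle u k s
  · exact ⟨_, Or.inl ⟨h, rfl⟩⟩
  by_cases h1 : S.Exact K u k s
  · exact ⟨_, Or.inr ⟨h, Or.inl ⟨h1, rfl⟩⟩⟩
  by_cases h2 : S.Jump u k s
  · obtain ⟨w, hw⟩ := S.exists_interp K u k s h
    exact ⟨w, Or.inr ⟨h, Or.inr ⟨h1, Or.inl ⟨h2, hw⟩⟩⟩⟩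
  · exact ⟨_, Or.inr ⟨h, Or.inr ⟨h1, Or.inr ⟨h2, rfl⟩⟩⟩⟩

/-- A run of the construction: `v s k` is the value of the slot `k` before stage `s`, and `K s`
lists the slots opened before stage `s`. -/
structure Run (v : ℕ → ℕ → α) (K : ℕ → List ℕ) : Prop where
  v_zero : ∀ k, v 0 k = S.bot
  K_zero : K 0 = []
  next : ∀ s, S.Next (K s) (v s) s.unpair.1 s (v (s + 1) s.unpair.1)
  v_succ : ∀ s k, k ≠ s.unpair.1 → v (s + 1) k = v s k
  K_succ_of : ∀ s, s.unpair.1 ∈ K s ∨ v (s + 1) s.unpair.1 ≤ S.bot → K (s + 1) = K s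
  K_succ : ∀ s, s.unpair.1 ∉ K s → ¬ v (s + 1) s.unpair.1 ≤ S.bot →
    K (s + 1) = K s ++ [s.unpair.1]

theorem Sep.anti {i n s s' : ℕ} (hs : s ≤ s') (h : S.Sep i n s') : S.Sep i n s := by
  intro j hj
  obtain ⟨t, ht, h1⟩ := h j hj
  exact ⟨t, ht, h1.imp (fun h2 h3 => h2 (h3.trans (S.mono _ hs)))
    (fun h2 h3 => h2 (h3.trans (S.mono _ hs)))⟩

theorem eventually_not_sep {i n : ℕ} (h : ¬ ∀ s, S.Sep i n s) :
    ∀ᶠ s in Filter.atTop, ¬ S.Sep i n s := by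
  push Not at h
  obtain ⟨s, hs⟩ := h
  exact Filter.eventually_atTop.2 ⟨s, fun t ht hsep => hs (hsep.anti S ht)⟩

/-- Only the finitely many pieces `t < n` count as evidence, and cofinality absorbs each of them at
some stage. Hence no slot of a repeated index stays active. -/
theorem eventually_not_sep_of_cofinal {i j n : ℕ} (hj : j < i) (h : Cofinal (S.a i) (S.a j)) :
    ∀ᶠ s in Filter.atTop, ¬ S.Sep i n s := by
  have h1 : ∀ t < n, ∀ᶠ s in Filter.atTop, S.a i t ≤ S.a j s ∧ S.a j t ≤ S.a i s := by
    intro t _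
    obtain ⟨x, hx⟩ := h.1 t
    obtain ⟨y, hy⟩ := h.2 t
    exact Filter.eventually_atTop.2 ⟨max x y, fun s hs =>
      ⟨hx.trans (S.mono _ ((le_max_left _ _).trans hs)),
       hy.trans (S.mono _ ((le_max_right _ _).trans hs))⟩⟩
  have h2 : ∀ᶠ s in Filter.atTop, ∀ t ∈ Set.Iio n, S.a i t ≤ S.a j s ∧ S.a j t ≤ S.a i s :=
    (Filter.eventually_all_finite (Set.finite_Iio n)).2 h1
  filter_upwards [h2] with s hs hsep
  obtain ⟨t, ht, h3⟩ := hsep j hj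
  exact h3.elim (fun h4 => h4 (hs t ht).1) (fun h4 => h4 (hs t ht).2)

theorem Act.unique {k l s : ℕ} (h : k.unpair.1 = l.unpair.1) (hk : S.Act k s)
    (hl : S.Act l s) : k = l := by
  rcases lt_trichotomy k.unpair.2 l.unpair.2 with h2 | h2 | h2
  · exact (hl.2 _ h2 (h ▸ hk.1)).elim
  · rw [← Nat.pair_unpair k, ← Nat.pair_unpair l, h, h2]
  · exact (hk.2 _ h2 (h ▸ hl.1)).elim

/-- Separation can only be lost as `s` grows, so each of the finitely many conditions in `Act`
changes its truth value at most once. -/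
theorem eventually_act_or (k : ℕ) :
    (∀ᶠ s in Filter.atTop, S.Act k s) ∨ ∀ᶠ s in Filter.atTop, ¬ S.Act k s := by
  by_cases h : ∀ s, S.Sep k.unpair.1 k.unpair.2 s
  · by_cases h1 : ∃ m < k.unpair.2, ∀ s, S.Sep k.unpair.1 m s
    · obtain ⟨m, hm, hs⟩ := h1
      exact Or.inr (Filter.Eventually.of_forall fun s hact => hact.2 m hm (hs s))
    · left
      push Not at h1
      have h2 : ∀ᶠ s in Filter.atTop, ∀ m ∈ Set.Iio k.unpair.2, ¬ S.Sep k.unpair.1 m s :=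
        (Filter.eventually_all_finite (Set.finite_Iio _)).2 fun m hm =>
          S.eventually_not_sep (by push Not; exact h1 m hm)
      filter_upwards [h2] with s hs using ⟨h s, hs⟩
  · right
    filter_upwards [S.eventually_not_sep h] with s hs hact using hs hact.1

theorem exists_sep {i : ℕ} (h : ∀ j < i, ¬ Cofinal (S.a i) (S.a j)) :
    ∃ n, ∀ s, S.Sep i n s := by
  have h1 : ∀ j, ∃ t, j < i → ∀ s, ¬ S.a i t ≤ S.a j s ∨ ¬ S.a j t ≤ S.a i s := by
    intro j
    by_cases hj : j < i
    · have h2 := h j hj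
      rw [Cofinal, not_and_or] at h2
      push Not at h2
      rcases h2 with ⟨t, ht⟩ | ⟨t, ht⟩
      · exact ⟨t, fun _ s => Or.inl (ht s)⟩
      · exact ⟨t, fun _ s => Or.inr (ht s)⟩
    · exact ⟨0, fun h => (hj h).elim⟩
  choose t ht using h1
  refine ⟨(Finset.range i).sup t + 1, fun s j hj => ⟨t j, ?_, ht j hj s⟩⟩
  exact Nat.lt_succ_of_le (Finset.le_sup (f := t) (Finset.mem_range.2 hj))

theorem exists_act {i : ℕ} (h : ∀ j < i, ¬ Cofinal (S.a i) (S.a j)) :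
    ∃ n, ∀ᶠ s in Filter.atTop, S.Act (Nat.pair i n) s := by
  classical
  have hex := S.exists_sep h
  refine ⟨Nat.find hex, ?_⟩
  have h2 : ∀ᶠ s in Filter.atTop, ∀ m ∈ Set.Iio (Nat.find hex), ¬ S.Sep i m s :=
    (Filter.eventually_all_finite (Set.finite_Iio _)).2 fun m hm =>
      S.eventually_not_sep (Nat.find_min hex hm)
  filter_upwards [h2] with s hs
  simp only [Act, Nat.unpair_pair]
  exact ⟨Nat.find_spec hex s, hs⟩

theorem exists_visit (k s : ℕ) : ∃ t, s ≤ t ∧ t.unpair.1 = k :=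
  ⟨Nat.pair k s, Nat.right_le_pair k s, by simp⟩

/-! ### Limits of slots: membership in the family and distinctness -/

namespace Run
variable {S} {v : ℕ → ℕ → α} {K : ℕ → List ℕ} (R : S.Run v K)
include R

theorem le_a (s k : ℕ) : v s k ≤ S.a k.unpair.1 s := by
  induction s with
  | zero => rw [R.v_zero]; exact S.bot_le _
  | succ s ih =>
    by_cases hk : k = s.unpair.1
    · refine le_trans ?_ (S.mono _ s.le_succ)
      have := R.next s
      rw [← hk] at this
      rcases this with ⟨-, h⟩ | ⟨-, ⟨-, h⟩ | ⟨-, ⟨-, h⟩ | ⟨-, h⟩⟩⟩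
      · rw [h]; exact ih
      · rw [h]
      · exact h.2.2.1
      · rw [h]; exact ih
    · rw [R.v_succ s k hk]
      exact ih.trans (S.mono _ s.le_succ)

theorem step (s k : ℕ) : v (s + 1) k = v s k ∨ (s.unpair.1 = k ∧ ¬ S.a k.unpair.1 s ≤ v s k ∧
    ((S.Exact (K s) (v s) k s ∧ v (s + 1) k = S.a k.unpair.1 s) ∨
      (S.Jump (v s) k s ∧ S.Interp (K s) (v s) k s (v (s + 1) k)))) := by
  by_cases hk : k = s.unpair.1
  · have := R.next s
    rw [← hk] at this
    rcases this with ⟨-, h⟩ | ⟨h0, ⟨h1, h⟩ | ⟨-, ⟨h1, h⟩ | ⟨-, h⟩⟩⟩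
    · exact Or.inl h
    · exact Or.inr ⟨hk.symm, fun h2 => h0 (Or.inr h2), Or.inl ⟨h1, h⟩⟩
    · exact Or.inr ⟨hk.symm, fun h2 => h0 (Or.inr h2), Or.inr ⟨h1, h⟩⟩
    · exact Or.inl h
  · exact Or.inl (R.v_succ s k hk)

theorem visit_exact {s k : ℕ} (hk : s.unpair.1 = k) (h : ¬ S.a k.unpair.1 s ≤ v s k)
    (he : S.Exact (K s) (v s) k s) : v (s + 1) k = S.a k.unpair.1 s := by
  have := R.next s
  rw [hk] at this
  rcases this with ⟨h0, -⟩ | ⟨-, ⟨-, h1⟩ | ⟨h1, -⟩⟩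
  · exact (h0.elim (fun h0 => h0 (R.le_a s k)) h).elim
  · exact h1
  · exact (h1 he).elim

theorem visit_jump {s k : ℕ} (hk : s.unpair.1 = k) (h : ¬ S.a k.unpair.1 s ≤ v s k)
    (hj : S.Jump (v s) k s) :
    v (s + 1) k = S.a k.unpair.1 s ∨ S.Interp (K s) (v s) k s (v (s + 1) k) := by
  have := R.next s
  rw [hk] at this
  rcases this with ⟨h0, -⟩ | ⟨-, ⟨-, h1⟩ | ⟨-, ⟨-, h1⟩ | ⟨h1, -⟩⟩⟩
  · exact (h0.elim (fun h0 => h0 (R.le_a s k)) h).elim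
  · exact Or.inl h1
  · exact Or.inr h1
  · exact (h1 hj).elim

theorem visit_jump_not_le {s k : ℕ} (hk : s.unpair.1 = k) (h : ¬ S.a k.unpair.1 s ≤ v s k)
    (hj : S.Jump (v s) k s) : ¬ v (s + 1) k ≤ v s k := by
  rcases R.visit_jump hk h hj with h1 | h1
  · rwa [h1]
  · exact h1.2.2.2.1

theorem le_succ (s k : ℕ) : v s k ≤ v (s + 1) k := by
  rcases R.step s k with h | ⟨-, -, ⟨-, h⟩ | ⟨-, h⟩⟩
  · rw [h]
  · rw [h]; exact R.le_a s k
  · exact h.2.1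

theorem v_mono (k : ℕ) : Monotone fun s => v s k := monotone_nat_of_le_succ fun s => R.le_succ s k

theorem mem_K (s k : ℕ) : k ∈ K s ↔ ¬ v s k ≤ S.bot := by
  induction s with
  | zero => simp [R.K_zero, R.v_zero]
  | succ s ih =>
    by_cases hk : k = s.unpair.1
    · by_cases h : s.unpair.1 ∈ K s ∨ v (s + 1) s.unpair.1 ≤ S.bot
      · rw [R.K_succ_of s h, ih]
        rw [← hk, ih] at h
        refine ⟨fun h1 h2 => h1 ((R.le_succ s k).trans h2), fun h1 => h.resolve_right h1⟩
      · push Not at h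
        rw [R.K_succ s h.1 h.2, hk]
        simpa using h.2
    · rw [R.v_succ s k hk, ← ih]
      by_cases h : s.unpair.1 ∈ K s ∨ v (s + 1) s.unpair.1 ≤ S.bot
      · rw [R.K_succ_of s h]
      · push Not at h
        rw [R.K_succ s h.1 h.2]
        simp [hk]

/-- A moving slot avoids the values of all opened slots, and unopened slots sit at bottom. -/
theorem not_equi (s k l : ℕ) (hkl : k ≠ l) (h : ¬ v s k ≤ S.bot) : ¬ Equi (v s k) (v s l) := by
  induction s generalizing k l with
  | zero => simp [R.v_zero] at h
  | succ s ih =>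
    have key : ∀ k l, k ≠ l → ¬ v (s + 1) k ≤ S.bot → k = s.unpair.1 →
        ¬ Equi (v (s + 1) k) (v (s + 1) l) := by
      intro k l hkl h hk he
      have hl : l ≠ s.unpair.1 := fun h => hkl (hk.trans h.symm)
      rw [R.v_succ s l hl] at he
      have hlb : ¬ v s l ≤ S.bot := fun h1 => h (he.1.trans h1)
      have hlK : l ∈ K s := (R.mem_K s l).2 hlb
      rcases R.step s k with h1 | ⟨-, -, ⟨h1, h2⟩ | ⟨-, h1⟩⟩
      · rw [h1] at he h
        exact ih k l hkl h he
      · rw [h2] at he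
        exact h1.2.2 ⟨l, hlK, he⟩
      · exact h1.2.2.2.2.2.1 ⟨l, hlK, he⟩
    intro he
    by_cases hk : k = s.unpair.1
    · exact key k l hkl h hk he
    by_cases hl : l = s.unpair.1
    · exact key l k hkl.symm (fun h1 => h (he.1.trans h1)) hl he.symm
    rw [R.v_succ s k hk] at h he
    rw [R.v_succ s l hl] at he
    exact ih k l hkl h he

/-- Every genuine move is strictly upward, so a slot at its maximum is literally constant and not
just constant up to equivalence. -/
theorem eq_of_stable {k s₀ : ℕ} (h : ∀ s, v s k ≤ v s₀ k) {s : ℕ} (hs : s₀ ≤ s) :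
    v s k = v s₀ k := by
  induction s, hs using Nat.le_induction with
  | base => rfl
  | succ s hs ih =>
    rw [← ih]
    rcases R.step s k with h1 | ⟨-, h0, ⟨-, h1⟩ | ⟨-, h1⟩⟩
    · exact h1
    · rw [← h1, ih] at h0
      exact (h0 (h _)).elim
    · refine (h1.2.2.2.1 ?_).elim
      rw [ih]
      exact h _

/-- A good limit is in the family by assumption. A limit that is neither good nor bottom calls for a
jump at every visit, active or not; since it no longer grows, `a i` must already lie below it. -/
theorem cofinal_of_principal {k : ℕ} (hp : Principal fun s => v s k)
    (ho : ∃ s, ¬ v s k ≤ S.bot) : ∃ i, Cofinal (fun s => v s k) (S.a i) := by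
  obtain ⟨s₀, hs₀⟩ := hp
  have heq := fun s hs => R.eq_of_stable hs₀ (s := s) hs
  obtain ⟨s₁, hs₁⟩ := ho
  have hb : ¬ v s₀ k ≤ S.bot := fun h => hs₁ ((hs₀ s₁).trans h)
  by_cases hg : S.good (v s₀ k)
  · obtain ⟨i, hi⟩ := S.good_mem _ hg
    refine ⟨i, fun s => ?_, fun s => ?_⟩
    · obtain ⟨t, ht⟩ := hi.1 0
      exact ⟨t, (hs₀ s).trans ht⟩
    · obtain ⟨t, ht⟩ := hi.2 s
      exact ⟨s₀, ht⟩
  · refine ⟨k.unpair.1, fun s => ⟨s, R.le_a s k⟩, fun s => ⟨s₀, ?_⟩⟩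
    obtain ⟨t, ht, hk⟩ := exists_visit k (max s s₀)
    have ht₀ : s₀ ≤ t := (le_max_right _ _).trans ht
    refine (S.mono _ ((le_max_left _ _).trans ht)).trans ?_
    by_contra hle
    replace hle : ¬ S.a k.unpair.1 t ≤ v s₀ k := hle
    rw [← heq t ht₀] at hle
    have hj : S.Jump (v t) k t := by
      rw [Jump, heq t ht₀]
      by_cases ha : S.Act k t
      · exact Or.inl ⟨ha, Or.inl hg⟩
      · exact Or.inr ⟨ha, hg, hb⟩
    refine R.visit_jump_not_le hk hle hj ?_
    rw [heq t ht₀]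
    exact hs₀ _

theorem stable_of_no_move {k s₀ : ℕ} (h : ∀ s ≥ s₀, v (s + 1) k = v s k) (s : ℕ) :
    v s k ≤ v s₀ k := by
  rcases le_total s s₀ with hs | hs
  · exact R.v_mono k hs
  · induction s, hs using Nat.le_induction with
    | base => exact le_rfl
    | succ s hs ih => rw [h s hs]; exact ih

/-- The first move after activity has ended lands on a good value, and an inactive slot with a good
value never moves again. -/
theorem principal_of_eventually_not_act {k : ℕ} (h : ∀ᶠ s in Filter.atTop, ¬ S.Act k s) :
    Principal fun s => v s k := by
  obtain ⟨s₀, hs₀⟩ := Filter.eventually_atTop.1 h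
  by_cases hm : ∀ s ≥ s₀, v (s + 1) k = v s k
  · exact ⟨s₀, R.stable_of_no_move hm⟩
  · push Not at hm
    obtain ⟨s₁, hs₁, hne⟩ := hm
    have hg : S.good (v (s₁ + 1) k) := by
      rcases R.step s₁ k with h1 | ⟨-, -, ⟨h1, -⟩ | ⟨-, h1⟩⟩
      · exact (hne h1).elim
      · exact (hs₀ s₁ hs₁ h1.1).elim
      · exact h1.1
    have hc : ∀ s ≥ s₁ + 1, v s k = v (s₁ + 1) k := by
      intro s hs
      induction s, hs using Nat.le_induction with
      | base => rfl
      | succ s hs ih =>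
        have hna : ¬ S.Act k s := hs₀ s (by omega)
        rcases R.step s k with h1 | ⟨-, -, ⟨h1, -⟩ | ⟨h1 | h1, -⟩⟩
        · rw [h1, ih]
        · exact (hna h1.1).elim
        · exact (hna h1.1).elim
        · rw [ih] at h1
          exact (h1.2.1 hg).elim
    exact ⟨s₁ + 1, R.stable_of_no_move fun s hs => by rw [hc s hs, hc (s + 1) (by omega)]⟩

theorem principal_of_exact {k s : ℕ} (hp : ∀ t, S.a k.unpair.1 t ≤ S.a k.unpair.1 s)
    (h : v (s + 1) k = S.a k.unpair.1 s) : Principal fun s => v s k :=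
  ⟨s + 1, fun t => by
    show v t k ≤ v (s + 1) k
    rw [h]; exact (R.le_a t k).trans (hp t)⟩

/-- Once `a i` is at its maximum, an exact move ends the growth. A jump gives a good value above
every earlier stage still strictly below the maximum, so no reason for another jump remains. -/
theorem principal_of_principal_a {k : ℕ} (h : ∀ᶠ s in Filter.atTop, S.Act k s)
    (hp : Principal (S.a k.unpair.1)) : Principal fun s => v s k := by
  obtain ⟨s₀, hs₀⟩ := Filter.eventually_atTop.1 h
  obtain ⟨s₁, hs₁⟩ := hp
  have hmax : ∀ s ≥ s₁, ∀ t, S.a k.unpair.1 t ≤ S.a k.unpair.1 s :=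
    fun s hs t => (hs₁ t).trans (S.mono _ hs)
  by_cases hm : ∀ s ≥ max s₀ s₁, v (s + 1) k = v s k
  · exact ⟨_, R.stable_of_no_move hm⟩
  push Not at hm
  obtain ⟨s₂, hs₂, hne⟩ := hm
  have hs₂₀ : s₀ ≤ s₂ := (le_max_left _ _).trans hs₂
  have hs₂₁ : s₁ ≤ s₂ := (le_max_right _ _).trans hs₂
  rcases R.step s₂ k with h1 | ⟨-, -, ⟨-, h1⟩ | ⟨-, hI⟩⟩
  · exact (hne h1).elim
  · exact R.principal_of_exact (hmax s₂ hs₂₁) h1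
  by_contra hnp
  have hc : ∀ s ≥ s₂ + 1, v s k = v (s₂ + 1) k := by
    intro s hs
    induction s, hs using Nat.le_induction with
    | base => rfl
    | succ s hs ih =>
      rcases R.step s k with h1 | ⟨-, -, ⟨-, h1⟩ | ⟨h1 | h1, -⟩⟩
      · rw [h1, ih]
      · exact (hnp (R.principal_of_exact (hmax s (by omega)) h1)).elim
      · rcases h1.2 with h2 | ⟨t, ht, h2, h3, h4⟩
        · rw [ih] at h2
          exact (h2 hI.1).elim
        · rw [ih] at h2 h4
          -- From `s₁` on, `a i` is maximal, so a strictly smaller stage is earlier than `s₁` and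
          -- was dominated by the jump at `s₂`.
          have ht₁ : t < s₁ := by
            by_contra hge
            exact h3 (hmax t (by omega) s)
          refine (h4 (hI.2.2.2.2.2.2 t (by omega) (hI.2.1.trans h2) ?_)).elim
          exact fun h5 => h3 ((hmax s₂ hs₂₁ s).trans h5)
      · exact (h1.1 (hs₀ s (by omega))).elim
  exact hnp ⟨s₂ + 1, R.stable_of_no_move fun s hs => by rw [hc s hs, hc (s + 1) (by omega)]⟩

theorem cofinal_a {k : ℕ} (h : ∀ᶠ s in Filter.atTop, S.Act k s)
    (hp : ¬ Principal (S.a k.unpair.1)) : Cofinal (fun s => v s k) (S.a k.unpair.1) := by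
  classical
  refine ⟨fun s => ⟨s, R.le_a s k⟩, fun t₀ => ?_⟩
  obtain ⟨s₀, hs₀⟩ := Filter.eventually_atTop.1 h
  set b := max s₀ t₀
  -- Take the first visit at which `a i` has outgrown stage `b`. Until then the value stays below `a
  -- i b`, so stage `b` itself either is dominated already or triggers a jump past it.
  have hex : ∃ s, b ≤ s ∧ s.unpair.1 = k ∧ ¬ S.a k.unpair.1 s ≤ S.a k.unpair.1 b := by
    unfold Principal at hp
    push Not at hp
    obtain ⟨t, ht⟩ := hp b
    obtain ⟨s, hs, hk⟩ := exists_visit k (max b t)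
    exact ⟨s, (le_max_left _ _).trans hs, hk,
      fun h1 => ht ((S.mono _ ((le_max_right _ _).trans hs)).trans h1)⟩
  obtain ⟨hs1, hs2, hs3⟩ := Nat.find_spec hex
  have hmin := fun m => Nat.find_min hex (m := m)
  set s := Nat.find hex
  have hd : ∀ r, b ≤ r → r ≤ s → v r k ≤ S.a k.unpair.1 b := by
    intro r hr
    induction r, hr using Nat.le_induction with
    | base => exact fun _ => R.le_a b k
    | succ r hr ih =>
      intro hrs
      have ih := ih (by omega)
      rcases R.step r k with h1 | ⟨hk, -, h1⟩
      · rw [h1]; exact ih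
      · have h2 : S.a k.unpair.1 r ≤ S.a k.unpair.1 b := by
          by_contra h3
          exact hmin r (by omega) ⟨hr, hk, h3⟩
        refine le_trans ?_ h2
        rcases h1 with ⟨-, h1⟩ | ⟨-, h1⟩
        · rw [h1]
        · exact h1.2.2.1
  have hds := hd s hs1 le_rfl
  have hbt : S.a k.unpair.1 t₀ ≤ S.a k.unpair.1 b := S.mono _ (le_max_right _ _)
  by_cases h1 : S.a k.unpair.1 b ≤ v s k
  · exact ⟨s, hbt.trans h1⟩
  have hbs : b < s := by
    rcases hs1.lt_or_eq with h2 | h2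
    · exact h2
    · exact (hs3 (by rw [← h2])).elim
  refine ⟨s + 1, hbt.trans ?_⟩
  have hna : ¬ S.a k.unpair.1 s ≤ v s k := fun h2 => hs3 (h2.trans hds)
  rcases R.visit_jump hs2 hna
    (Or.inl ⟨hs₀ s ((le_max_left _ _).trans hs1), Or.inr ⟨b, hbs, hds, hs3, h1⟩⟩) with h2 | h2
  · show _ ≤ v (s + 1) k
    rw [h2]; exact S.mono _ hs1
  · exact h2.2.2.2.2.2.2 b hbs hds hs3

theorem not_principal {k : ℕ} (h : ¬ Principal fun s => v s k) :
    (∀ᶠ s in Filter.atTop, S.Act k s) ∧ Cofinal (fun s => v s k) (S.a k.unpair.1) := by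
  rcases S.eventually_act_or k with h1 | h1
  · exact ⟨h1, R.cofinal_a h1 fun hp => h (R.principal_of_principal_a h1 hp)⟩
  · exact (h (R.principal_of_eventually_not_act h1)).elim

theorem exists_cofinal {k : ℕ} (ho : ∃ s, ¬ v s k ≤ S.bot) :
    ∃ i, Cofinal (fun s => v s k) (S.a i) := by
  by_cases h : Principal fun s => v s k
  · exact R.cofinal_of_principal h ho
  · exact ⟨_, (R.not_principal h).2⟩

/-- Clopen limits are both reached at a finite stage, where `not_equi` applies. Otherwise both slots
are permanently active with cofinal sequences: different indices would destroy the separation of the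
larger one, and equal indices have only one active slot. -/
theorem not_cofinal {k l : ℕ} (hkl : k ≠ l) (ho : ∃ s, ¬ v s k ≤ S.bot) :
    ¬ Cofinal (fun s => v s k) (fun s => v s l) := by
  intro hc
  by_cases h : Principal fun s => v s k
  · obtain ⟨x, hx⟩ := h
    obtain ⟨y, hy⟩ := Principal.of_cofinal ⟨x, hx⟩ hc
    obtain ⟨z, hz⟩ := ho
    set m := max x (max y z)
    have hxm : x ≤ m := le_max_left _ _
    have hym : y ≤ m := (le_max_left _ _).trans (le_max_right _ _)
    have hzm : z ≤ m := (le_max_right _ _).trans (le_max_right _ _)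
    refine R.not_equi m k l hkl (fun h1 => hz ((R.v_mono k hzm).trans h1)) ⟨?_, ?_⟩
    · obtain ⟨t, ht⟩ := hc.1 m
      exact ht.trans ((hy t).trans (R.v_mono l hym))
    · obtain ⟨t, ht⟩ := hc.2 m
      exact ht.trans ((hx t).trans (R.v_mono k hxm))
  · have hl : ¬ Principal fun s => v s l := fun hl => h (hl.of_cofinal hc.symm)
    obtain ⟨hk1, hk2⟩ := R.not_principal h
    obtain ⟨hl1, hl2⟩ := R.not_principal hl
    have hcc : Cofinal (S.a k.unpair.1) (S.a l.unpair.1) := hk2.symm.trans (hc.trans hl2)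
    rcases lt_trichotomy k.unpair.1 l.unpair.1 with h1 | h1 | h1
    · obtain ⟨s, hs1, hs2⟩ := (hl1.and (S.eventually_not_sep_of_cofinal (n := l.unpair.2)
        h1 hcc.symm)).exists
      exact hs2 hs1.1
    · obtain ⟨s, hs1, hs2⟩ := (hk1.and hl1).exists
      exact hkl (hs1.unique S h1 hs2)
    · obtain ⟨s, hs1, hs2⟩ := (hk1.and (S.eventually_not_sep_of_cofinal (n := k.unpair.2)
        h1 hcc)).exists
      exact hs2 hs1.1

end Run

/-! ### Every nonbottom sequence has a slot -/

theorem eventually_not_equi {j : ℕ} {e : α} (h : ¬ Cofinal (fun _ => e) (S.a j)) :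
    ∀ᶠ s in Filter.atTop, ¬ Equi e (S.a j s) := by
  by_cases h1 : ∃ t, ¬ S.a j t ≤ e
  · obtain ⟨t, ht⟩ := h1
    exact Filter.eventually_atTop.2 ⟨t, fun s hs he => ht ((S.mono j hs).trans he.2)⟩
  · push Not at h1
    exact Filter.Eventually.of_forall fun s he => h ⟨fun _ => ⟨s, he.1⟩, fun t => ⟨0, h1 t⟩⟩

namespace Run
variable {S} {v : ℕ → ℕ → α} {K : ℕ → List ℕ} (R : S.Run v K)
include R

theorem cofinal_of_eventually_equi {k s : ℕ} {e : α} (h : ∀ t ≥ s, Equi (v t k) e) :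
    Cofinal (fun s => v s k) (fun _ => e) :=
  ⟨fun t => ⟨0, (R.v_mono k (le_max_left t s)).trans (h _ (le_max_right _ _)).1⟩,
    fun _ => ⟨s, (h s le_rfl).2⟩⟩

/-- Values increase, so a slot that leaves the class of `e` never returns to it. -/
theorem eventually_not_equi {k : ℕ} {e : α} (h : ¬ Cofinal (fun s => v s k) (fun _ => e)) :
    ∀ᶠ s in Filter.atTop, ¬ Equi (v s k) e := by
  by_cases h1 : ∃ s, Equi (v s k) e
  · obtain ⟨s, hs⟩ := h1
    have h2 : ∃ t ≥ s, ¬ Equi (v t k) e := by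
      by_contra hc
      push Not at hc
      exact h (R.cofinal_of_eventually_equi hc)
    obtain ⟨t, hst, ht⟩ := h2
    refine Filter.eventually_atTop.2 ⟨t, fun r hr he => ht ⟨?_, ?_⟩⟩
    · exact (R.v_mono k hr).trans he.1
    · exact hs.2.trans (R.v_mono k hst)
  · push Not at h1
    exact Filter.Eventually.of_forall h1

theorem exists_slot_of_minimal {i : ℕ} (hb : ∃ s, ¬ S.a i s ≤ S.bot)
    (hmin : ∀ j < i, ¬ Cofinal (S.a i) (S.a j)) :
    ∃ k, Cofinal (fun s => v s k) (S.a i) := by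
  obtain ⟨n, hact⟩ := S.exists_act hmin
  set k₀ := Nat.pair i n
  have hk₀ : k₀.unpair.1 = i := by simp [k₀]
  by_cases hp : Principal (S.a i)
  swap
  · have := R.cofinal_a hact (by rwa [hk₀])
    rw [hk₀] at this
    exact ⟨k₀, this⟩
  obtain ⟨s₀, hs₀⟩ := hp
  set e := S.a i s₀
  have hee : Cofinal (fun _ => e) (S.a i) := ⟨fun _ => ⟨s₀, le_rfl⟩, fun t => ⟨0, hs₀ t⟩⟩
  have heb : ¬ e ≤ S.bot := fun h => by
    obtain ⟨s, hs⟩ := hb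
    exact hs ((hs₀ s).trans h)
  by_contra hno
  push Not at hno
  have hno' : ∀ k, ¬ Cofinal (fun s => v s k) (fun _ => e) :=
    fun k hk => hno k (hk.trans hee)
  have hlow : ∀ᶠ s in Filter.atTop, ∀ k ∈ Set.Iic i, ¬ Equi (v s k) e :=
    (Filter.eventually_all_finite (Set.finite_Iic i)).2 fun k _ => R.eventually_not_equi (hno' k)
  have hsmall : ∀ᶠ s in Filter.atTop, ∀ j ∈ Set.Iio i, ¬ Equi e (S.a j s) :=
    (Filter.eventually_all_finite (Set.finite_Iio i)).2 fun j hj =>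
      S.eventually_not_equi fun h => hmin j hj (hee.symm.trans h)
  obtain ⟨s₂, hs₂⟩ := Filter.eventually_atTop.1
    (((hlow.and hsmall).and hact).and (Filter.eventually_ge_atTop s₀))
  have hai : ∀ s ≥ s₂, Equi (S.a i s) e := fun s hs => ⟨hs₀ s, S.mono i (hs₂ s hs).2⟩
  -- After `s₂` nothing moves onto `e`. Exact moves are excluded for smaller indices because they do
  -- not show `e`, for larger ones because `a i` does; for `i` itself the move would give the slot
  -- sought. Jumps of slots `k > i` avoid `a i s`, and slots `k ≤ i` have left `e` for good.
  have hstep : ∀ s ≥ s₂, ∀ k, ¬ Equi (v s k) e → ¬ Equi (v (s + 1) k) e := by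
    intro s hs k hk he
    rcases R.step s k with h | ⟨-, -, ⟨hex, h⟩ | ⟨-, hI⟩⟩
    · exact hk (h ▸ he)
    · have hai' : Equi (S.a k.unpair.1 s) e := h ▸ he
      rcases lt_trichotomy k.unpair.1 i with h1 | h1 | h1
      · exact (hs₂ s hs).1.1.2 _ h1 hai'.symm
      · have : k = k₀ := hex.1.unique S (h1.trans hk₀.symm) (hs₂ s hs).1.2
        refine hno k ⟨fun t => ⟨t, h1 ▸ R.le_a t k⟩, fun t => ⟨s + 1, ?_⟩⟩
        exact (hs₀ t).trans he.2
      · exact hex.2.1 i h1 (hai'.trans (hai s hs).symm)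
    · have hki : k ≤ i := by
        by_contra hlt
        exact hI.2.2.2.2.1 i (by omega) (he.trans (hai s hs).symm)
      exact (hs₂ (s + 1) (by omega)).1.1.1 k hki he
  have hprop : ∀ s ≥ s₂, ∀ k, ¬ Equi (v s k) e → ∀ t ≥ s, ¬ Equi (v t k) e := by
    intro s hs k hk t ht
    induction t, ht using Nat.le_induction with
    | base => exact hk
    | succ t ht ih => exact hstep t (hs.trans ht) k ih
  -- At most one slot holds `e` at stage `s₂`, and by assumption it eventually gives it up.
  obtain ⟨s₃, hs₃, hnone⟩ : ∃ s₃ ≥ s₂, ∀ k, ¬ Equi (v s₃ k) e := by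
    by_cases h : ∃ k, Equi (v s₂ k) e
    · obtain ⟨k₁, hk₁⟩ := h
      obtain ⟨t, ht⟩ := Filter.eventually_atTop.1 (R.eventually_not_equi (hno' k₁))
      refine ⟨max t s₂, le_max_right _ _, fun k => ?_⟩
      by_cases hkk : k = k₁
      · rw [hkk]; exact ht _ (le_max_left _ _)
      · refine hprop s₂ le_rfl k (fun he => ?_) _ (le_max_right _ _)
        exact R.not_equi s₂ k₁ k (Ne.symm hkk) (fun h1 => heb (hk₁.2.trans h1))
          (hk₁.trans he.symm)
    · push Not at h
      exact ⟨s₂, le_rfl, h⟩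
  obtain ⟨s, hs, hk⟩ := exists_visit k₀ s₃
  have hs' : s₂ ≤ s := hs₃.trans hs
  have hnone' : ∀ k, ¬ Equi (v s k) e := fun k => hprop s₃ hs₃ k (hnone k) s hs
  -- With `e` free, the next visit to the active slot of `i` must take it, contradicting `hstep`.
  have hex : S.Exact (K s) (v s) k₀ s := by
    refine ⟨(hs₂ s hs').1.2, ?_, ?_⟩
    · rw [hk₀]
      exact fun j hj he => (hs₂ s hs').1.1.2 j hj ((hai s hs').symm.trans he)
    · rw [hk₀]
      rintro ⟨l, -, hl⟩
      exact hnone' l (hl.symm.trans (hai s hs'))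
  have hv := R.visit_exact hk (fun hle => hnone' k₀ ⟨?_, ?_⟩) hex
  · rw [hk₀] at hv
    refine hstep s hs' k₀ (hnone' k₀) ?_
    rw [hv]
    exact hai s hs'
  · have := R.le_a s k₀
    rw [hk₀] at this
    exact this.trans (hs₀ s)
  · rw [hk₀] at hle
    exact (hai s hs').2.trans hle

theorem exists_slot {i : ℕ} (hb : ∃ s, ¬ S.a i s ≤ S.bot) :
    ∃ k, Cofinal (fun s => v s k) (S.a i) := by
  classical
  have hex : ∃ j, Cofinal (S.a i) (S.a j) := ⟨i, fun s => ⟨s, le_rfl⟩, fun s => ⟨s, le_rfl⟩⟩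
  have hc := Nat.find_spec hex
  obtain ⟨k, hk⟩ := R.exists_slot_of_minimal (i := Nat.find hex)
    (by
      obtain ⟨s, hs⟩ := hb
      obtain ⟨t, ht⟩ := hc.1 s
      exact ⟨t, fun h => hs (ht.trans h)⟩)
    fun j hj h => Nat.find_min hex hj (hc.trans h)
  exact ⟨k, hk.trans hc.symm⟩

/-- Finitely many slots have finitely many principal limits. Density supplies a good element
avoiding them all, yet it too must be the limit of a slot. This makes the renumbering by opening
order total. -/
theorem infinite_opened : {k | ∃ s, ¬ v s k ≤ S.bot}.Infinite := by
  intro hfin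
  have hgen : ∀ k, ∃ p, (Principal fun s => v s k) → Cofinal (fun s => v s k) fun _ => p := by
    intro k
    by_cases h : Principal fun s => v s k
    · obtain ⟨s, hs⟩ := h
      exact ⟨v s k, fun _ => ⟨fun t => ⟨0, hs t⟩, fun _ => ⟨s, le_rfl⟩⟩⟩
    · exact ⟨S.bot, fun h' => (h h').elim⟩
  choose p hp using hgen
  obtain ⟨e, he⟩ := S.nontrivial
  obtain ⟨c, hc, -, -, hcT⟩ := S.dense S.bot e (S.bot_le e) he (hfin.toFinset.toList.map p)
  obtain ⟨i, hi⟩ := S.good_mem c hc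
  have hcb := S.not_good_bot c hc
  obtain ⟨k, hk⟩ := R.exists_slot (i := i) (by
    obtain ⟨t, ht⟩ := hi.1 0
    exact ⟨t, fun h => hcb (ht.trans h)⟩)
  have hck : Cofinal (fun _ => c) (fun s => v s k) := hi.trans hk.symm
  have hpk : Cofinal (fun _ : ℕ => c) fun _ => p k :=
    hck.trans (hp k (Principal.of_cofinal (f := fun _ => c) ⟨0, fun _ => le_rfl⟩ hck))
  refine hcT (p k) ?_ ⟨(hpk.1 0).choose_spec, (hpk.2 0).choose_spec⟩
  refine List.mem_map.2 ⟨k, ?_, rfl⟩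
  simp only [Finset.mem_toList, Set.Finite.mem_toFinset, Set.mem_ofPred_eq]
  obtain ⟨t, ht⟩ := hck.1 0
  exact ⟨t, fun h => hcb (ht.trans h)⟩

/-! ### Renumbering the slots by order of opening -/

theorem K_prefix {s t : ℕ} (h : s ≤ t) : K s <+: K t := by
  induction t, h using Nat.le_induction with
  | base => exact List.prefix_rfl
  | succ t ht ih =>
    refine ih.trans ?_
    by_cases h : t.unpair.1 ∈ K t ∨ v (t + 1) t.unpair.1 ≤ S.bot
    · rw [R.K_succ_of t h]
    · push Not at h
      rw [R.K_succ t h.1 h.2]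
      exact List.prefix_append _ _

theorem nodup_K (s : ℕ) : (K s).Nodup := by
  induction s with
  | zero => simp [R.K_zero]
  | succ s ih =>
    by_cases h : s.unpair.1 ∈ K s ∨ v (s + 1) s.unpair.1 ≤ S.bot
    · rwa [R.K_succ_of s h]
    · push Not at h
      rw [R.K_succ s h.1 h.2, List.nodup_append]
      refine ⟨ih, by simp, ?_⟩
      intro a ha b hb hab
      rw [List.mem_singleton] at hb
      exact h.1 (hb ▸ hab ▸ ha)

theorem exists_le_length (N : ℕ) : ∃ s, N ≤ (K s).length := by
  classical
  obtain ⟨F, hF, hcard⟩ := R.infinite_opened.exists_subset_card_eq N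
  have h : ∀ k ∈ F, ∀ᶠ s in Filter.atTop, k ∈ K s := by
    intro k hk
    obtain ⟨s, hs⟩ := hF hk
    refine Filter.eventually_atTop.2 ⟨s, fun t ht => (R.mem_K t k).2 fun h => hs ?_⟩
    exact (R.v_mono k ht).trans h
  obtain ⟨s, hs⟩ := ((Filter.eventually_all_finset F).2 h).exists
  refine ⟨s, hcard ▸ ?_⟩
  calc F.card ≤ (K s).toFinset.card :=
        Finset.card_le_card fun k hk => List.mem_toFinset.2 (hs k hk)
    _ ≤ (K s).length := List.toFinset_card_le _

end Run

/-- The value at stage `s` of the slot that is opened as number `x`. -/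
def slotValue (v : ℕ → ℕ → α) (K : ℕ → List ℕ) (x s : ℕ) : α :=
  (((K s)[x]?).map (v s)).getD S.bot

namespace Run
variable {S} {v : ℕ → ℕ → α} {K : ℕ → List ℕ} (R : S.Run v K)
include R

/-- The list of opened slots only grows at its end, so position `x` always means the same slot; the
default bottom before its opening does not affect the limit. -/
theorem cofinal_slotValue {x k s : ℕ} (h : (K s)[x]? = some k) :
    Cofinal (S.slotValue v K x) (fun s => v s k) := by
  refine ⟨fun t => ?_, fun t => ⟨max s t, ?_⟩⟩
  · by_cases hx : x < (K t).length
    · have hk : (K t)[x]? = some k := by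
        rcases le_total s t with hst | hst
        · exact List.prefix_iff_getElem?.1 (R.K_prefix hst) x
            (List.getElem?_eq_some_iff.1 h).1 ▸ ((List.getElem?_eq_getElem _).symm.trans h)
        · have := List.prefix_iff_getElem?.1 (R.K_prefix hst) x hx
          rw [h] at this
          rw [List.getElem?_eq_getElem hx, this]
      exact ⟨t, by simp [slotValue, hk]⟩
    · refine ⟨t, ?_⟩
      rw [slotValue, List.getElem?_eq_none (not_lt.1 hx)]
      exact S.bot_le _
  · have hk : (K (max s t))[x]? = some k :=
      List.prefix_iff_getElem?.1 (R.K_prefix (le_max_left s t)) x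
        (List.getElem?_eq_some_iff.1 h).1 ▸ ((List.getElem?_eq_getElem _).symm.trans h)
    simp only [slotValue, hk, Option.map_some, Option.getD_some]
    exact R.v_mono k (le_max_right _ _)

theorem exists_slotValue (x : ℕ) : ∃ k s, (K s)[x]? = some k := by
  obtain ⟨s, hs⟩ := R.exists_le_length (x + 1)
  exact ⟨_, s, List.getElem?_eq_getElem (by omega)⟩

theorem opened_of_getElem? {x k s : ℕ} (h : (K s)[x]? = some k) : ∃ s, ¬ v s k ≤ S.bot :=
  ⟨s, (R.mem_K s k).1 (List.mem_of_getElem? h)⟩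

theorem slotValue_mem (x : ℕ) : ∃ i, Cofinal (S.slotValue v K x) (S.a i) := by
  obtain ⟨k, s, h⟩ := R.exists_slotValue x
  obtain ⟨i, hi⟩ := R.exists_cofinal (R.opened_of_getElem? h)
  exact ⟨i, (R.cofinal_slotValue h).trans hi⟩

theorem slotValue_not_le_bot (x : ℕ) : ∃ s, ¬ S.slotValue v K x s ≤ S.bot := by
  obtain ⟨k, s, h⟩ := R.exists_slotValue x
  obtain ⟨t, ht⟩ := R.opened_of_getElem? h
  obtain ⟨r, hr⟩ := (R.cofinal_slotValue h).2 t
  exact ⟨r, fun h1 => ht (hr.trans h1)⟩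

theorem exists_cofinal_slotValue {i : ℕ} (hb : ∃ s, ¬ S.a i s ≤ S.bot) :
    ∃ x, Cofinal (S.slotValue v K x) (S.a i) := by
  obtain ⟨k, hk⟩ := R.exists_slot hb
  obtain ⟨s, hs⟩ := hb
  obtain ⟨t, ht⟩ := hk.2 s
  obtain ⟨x, hx⟩ := List.mem_iff_getElem?.1 ((R.mem_K t k).2 fun h => hs (ht.trans h))
  exact ⟨x, (R.cofinal_slotValue hx).trans hk⟩

theorem slotValue_injective {x y : ℕ}
    (h : Cofinal (S.slotValue v K x) (S.slotValue v K y)) : x = y := by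
  obtain ⟨k, s, hk⟩ := R.exists_slotValue x
  obtain ⟨l, t, hl⟩ := R.exists_slotValue y
  have hc := (R.cofinal_slotValue hk).symm.trans (h.trans (R.cofinal_slotValue hl))
  have hkl : k = l := by
    by_contra hne
    exact R.not_cofinal hne (R.opened_of_getElem? hk) hc
  subst hkl
  have hk' : (K (max s t))[x]? = some k :=
    List.prefix_iff_getElem?.1 (R.K_prefix (le_max_left s t)) x
      (List.getElem?_eq_some_iff.1 hk).1 ▸ ((List.getElem?_eq_getElem _).symm.trans hk)
  have hl' : (K (max s t))[y]? = some k :=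
    List.prefix_iff_getElem?.1 (R.K_prefix (le_max_right s t)) y
      (List.getElem?_eq_some_iff.1 hl).1 ▸ ((List.getElem?_eq_getElem _).symm.trans hl)
  exact (List.getElem?_inj (List.getElem?_eq_some_iff.1 hk').1 (R.nodup_K _)).1
    (hk'.trans hl'.symm)

end Run
end ApproxSystem

/-! ### Computability of the construction -/

theorem Computable.exists_choice {α β : Type*} [Primcodable α] [Primcodable β] [Nonempty α]
    {R : β → α → Prop} (hR : PrimrecRel R) (h : ∀ b, ∃ a, R b a) :
    ∃ f : β → α, Computable f ∧ ∀ b, R b (f b) := by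
  classical
  let P : β → ℕ → Prop := fun b n => ((Encodable.decode n : Option α).map
    fun a => decide (R b a)).getD false = true
  have hP : ∀ b, ∃ n, P b n := fun b => by
    obtain ⟨a, ha⟩ := h b
    exact ⟨Encodable.encode a, by simp [P, ha]⟩
  have hPc : ComputablePred fun p : β × ℕ => P p.1 p.2 := by
    refine PrimrecPred.computablePred ?_
    refine Primrec.eq.comp (Primrec.option_getD.comp (Primrec.option_map
      (Primrec.decode.comp Primrec.snd) ?_) (Primrec.const false)) (Primrec.const true)
    exact hR.decide.comp (Primrec.fst.comp Primrec.fst) Primrec.snd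
  -- The fallback is never used, since `P` fails at numbers that decode to nothing.
  refine ⟨fun b => ((Encodable.decode (Nat.find (hP b)) : Option α)).getD
    (Classical.arbitrary α), ?_, fun b => ?_⟩
  · exact Computable.option_getD (Computable.decode.comp (Computable.find hPc hP))
      (Computable.const _)
  · have := Nat.find_spec (hP b)
    revert this
    simp only [P]
    cases (Encodable.decode (Nat.find (hP b)) : Option α) <;> simp

namespace ApproxSystem
variable {α : Type*} [Preorder α] [Primcodable α] (S : ApproxSystem α)

/-- The value of slot `k` recorded in the log `L`. -/
def logValue (L : List (ℕ × α)) (k : ℕ) : α := (L.lookup k).getD S.bot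

section Primrec
variable (hle : PrimrecRel fun c d : α => c ≤ d) (hgood : PrimrecPred S.good)
  (ha : Primrec₂ S.a)

theorem primrec_logValue : Primrec₂ S.logValue :=
  Primrec.option_getD.comp (Primrec.listLookup.comp Primrec.snd Primrec.fst) (Primrec.const _)

omit [Preorder α] S hle hgood ha in
theorem _root_.PrimrecPred.forall_lt_comp {γ : Type*} [Primcodable γ] {P : γ → ℕ → Prop}
    {f : γ → ℕ} (hf : Primrec f) (hP : PrimrecPred fun p : γ × ℕ => P p.1 p.2) :
    PrimrecPred fun x => ∀ t < f x, P x t :=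
  ((PrimrecRel.forall_mem_list (R := fun t x => P x t)
    (hP.comp (Primrec.snd.pair Primrec.fst))).comp (Primrec.list_range.comp hf)
    Primrec.id).of_eq fun x => by simp

theorem _root_.PrimrecPred.exists_lt_comp {γ : Type*} [Primcodable γ] {P : γ → ℕ → Prop}
    {f : γ → ℕ} (hf : Primrec f) (hP : PrimrecPred fun p : γ × ℕ => P p.1 p.2) :
    PrimrecPred fun x => ∃ t < f x, P x t :=
  ((PrimrecRel.exists_mem_list (R := fun t x => P x t)
    (hP.comp (Primrec.snd.pair Primrec.fst))).comp (Primrec.list_range.comp hf)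
    Primrec.id).of_eq fun x => by simp

theorem _root_.PrimrecPred.exists_mem_comp {γ β : Type*} [Primcodable γ] [Primcodable β]
    {P : γ → β → Prop} {f : γ → List β} (hf : Primrec f)
    (hP : PrimrecPred fun p : γ × β => P p.1 p.2) :
    PrimrecPred fun x => ∃ t ∈ f x, P x t :=
  (PrimrecRel.exists_mem_list (R := fun t x => P x t)
    (hP.comp (Primrec.snd.pair Primrec.fst))).comp hf Primrec.id

variable {γ : Type*} [Primcodable γ]

theorem primrecPred_equi (hle : PrimrecRel fun c d : α => c ≤ d) {f g : γ → α}
    (hf : Primrec f) (hg : Primrec g) : PrimrecPred fun x => Equi (f x) (g x) :=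
  (hle.comp hf hg).and (hle.comp hg hf)

include hle ha

theorem primrecPred_sep {i n s : γ → ℕ} (hi : Primrec i) (hn : Primrec n) (hs : Primrec s) :
    PrimrecPred fun x => S.Sep (i x) (n x) (s x) := by
  refine PrimrecPred.forall_lt_comp hi (PrimrecPred.exists_lt_comp (hn.comp Primrec.fst) ?_)
  have hi' : Primrec fun p : (γ × ℕ) × ℕ => i p.1.1 := hi.comp (Primrec.fst.comp Primrec.fst)
  have hs' : Primrec fun p : (γ × ℕ) × ℕ => s p.1.1 := hs.comp (Primrec.fst.comp Primrec.fst)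
  have hj : Primrec fun p : (γ × ℕ) × ℕ => p.1.2 := Primrec.snd.comp Primrec.fst
  exact (hle.comp (ha.comp hi' Primrec.snd) (ha.comp hj hs')).not.or
    (hle.comp (ha.comp hj Primrec.snd) (ha.comp hi' hs')).not

theorem primrecPred_act {k s : γ → ℕ} (hk : Primrec k) (hs : Primrec s) :
    PrimrecPred fun x => S.Act (k x) (s x) := by
  have h1 := Primrec.fst.comp (Primrec.unpair.comp hk)
  have h2 := Primrec.snd.comp (Primrec.unpair.comp hk)
  exact (S.primrecPred_sep hle ha h1 h2 hs).and (PrimrecPred.forall_lt_comp h2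
    (S.primrecPred_sep hle ha (h1.comp Primrec.fst) Primrec.snd (hs.comp Primrec.fst)).not)

omit ha in
theorem primrecPred_held {K : γ → List ℕ} {L : γ → List (ℕ × α)} {c : γ → α} (hK : Primrec K)
    (hL : Primrec L) (hc : Primrec c) :
    PrimrecPred fun x => Held (K x) (S.logValue (L x)) (c x) :=
  PrimrecPred.exists_mem_comp hK (primrecPred_equi hle (hc.comp Primrec.fst)
    (S.primrec_logValue.comp (hL.comp Primrec.fst) Primrec.snd))

theorem primrecPred_exact {K : γ → List ℕ} {L : γ → List (ℕ × α)} {k s : γ → ℕ}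
    (hK : Primrec K) (hL : Primrec L) (hk : Primrec k) (hs : Primrec s) :
    PrimrecPred fun x => S.Exact (K x) (S.logValue (L x)) (k x) (s x) := by
  have h1 := Primrec.fst.comp (Primrec.unpair.comp hk)
  have h2 := ha.comp h1 hs
  exact (S.primrecPred_act hle ha hk hs).and ((PrimrecPred.forall_lt_comp h1
    (primrecPred_equi hle (h2.comp Primrec.fst)
      (ha.comp Primrec.snd (hs.comp Primrec.fst))).not).and (S.primrecPred_held hle hK hL h2).not)

include hgood

theorem primrecPred_jump {L : γ → List (ℕ × α)} {k s : γ → ℕ}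
    (hL : Primrec L) (hk : Primrec k) (hs : Primrec s) :
    PrimrecPred fun x => S.Jump (S.logValue (L x)) (k x) (s x) := by
  have h1 := Primrec.fst.comp (Primrec.unpair.comp hk)
  have h2 := ha.comp h1 hs
  have hu := S.primrec_logValue.comp hL hk
  have hact := S.primrecPred_act hle ha hk hs
  have ht := ha.comp (h1.comp (Primrec.fst (β := ℕ))) Primrec.snd
  have hu' := hu.comp (Primrec.fst (β := ℕ))
  exact (hact.and ((hgood.comp hu).not.or (PrimrecPred.exists_lt_comp hs
    ((hle.comp hu' ht).and ((hle.comp (h2.comp Primrec.fst) ht).not.and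
      (hle.comp ht hu').not))))).or
    (hact.not.and ((hgood.comp hu).not.and (hle.comp hu (Primrec.const _)).not))

theorem primrecPred_interp {K : γ → List ℕ} {L : γ → List (ℕ × α)} {k s : γ → ℕ} {w : γ → α}
    (hK : Primrec K) (hL : Primrec L) (hk : Primrec k) (hs : Primrec s) (hw : Primrec w) :
    PrimrecPred fun x => S.Interp (K x) (S.logValue (L x)) (k x) (s x) (w x) := by
  have h1 := Primrec.fst.comp (Primrec.unpair.comp hk)
  have h2 := ha.comp h1 hs
  have hu := S.primrec_logValue.comp hL hk
  have ht := ha.comp (h1.comp (Primrec.fst (β := ℕ))) Primrec.snd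
  refine (hgood.comp hw).and ((hle.comp hu hw).and ((hle.comp hw h2).and
    ((hle.comp hw hu).not.and (PrimrecPred.and ?_ (PrimrecPred.and ?_ ?_)))))
  · exact PrimrecPred.forall_lt_comp hk (primrecPred_equi hle (hw.comp Primrec.fst)
      (ha.comp Primrec.snd (hs.comp Primrec.fst))).not
  · exact (S.primrecPred_held hle hK hL hw).not
  · refine PrimrecPred.forall_lt_comp hs (PrimrecPred.of_eq (PrimrecPred.or
      (hle.comp (hu.comp Primrec.fst) ht).not (PrimrecPred.or
        (hle.comp (h2.comp Primrec.fst) ht) (hle.comp ht (hw.comp Primrec.fst)))) fun p => ?_)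
    tauto

theorem primrecPred_next {K : γ → List ℕ} {L : γ → List (ℕ × α)} {k s : γ → ℕ} {w : γ → α}
    (hK : Primrec K) (hL : Primrec L) (hk : Primrec k) (hs : Primrec s) (hw : Primrec w) :
    PrimrecPred fun x => S.Next (K x) (S.logValue (L x)) (k x) (s x) (w x) := by
  have h1 := Primrec.fst.comp (Primrec.unpair.comp hk)
  have h2 := ha.comp h1 hs
  have hu := S.primrec_logValue.comp hL hk
  have hidle : PrimrecPred fun x => S.Idle (S.logValue (L x)) (k x) (s x) :=
    (hle.comp hu h2).not.or (hle.comp h2 hu)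
  have hstay := Primrec.eq.comp hw hu
  have hex := S.primrecPred_exact hle ha hK hL hk hs
  have hj := S.primrecPred_jump hle hgood ha hL hk hs
  exact (hidle.and hstay).or (hidle.not.and ((hex.and (Primrec.eq.comp hw h2)).or
    (hex.not.and ((hj.and (S.primrecPred_interp hle hgood ha hK hL hk hs hw)).or
      (hj.not.and hstay)))))

end Primrec

/-- The state after writing the value `w` of slot `k`. -/
noncomputable def record (σ : List ℕ × List (ℕ × α)) (k : ℕ) (w : α) : List ℕ × List (ℕ × α) :=
  open Classical in
  (if k ∈ σ.1 ∨ w ≤ S.bot then σ.1 else σ.1 ++ [k], (k, w) :: σ.2)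

theorem primrec_record (hle : PrimrecRel fun c d : α => c ≤ d) :
    Primrec fun p : (List ℕ × List (ℕ × α)) × ℕ × α => S.record p.1 p.2.1 p.2.2 := by
  classical
  have hK : Primrec fun p : (List ℕ × List (ℕ × α)) × ℕ × α => p.1.1 :=
    Primrec.fst.comp Primrec.fst
  have hk : Primrec fun p : (List ℕ × List (ℕ × α)) × ℕ × α => p.2.1 :=
    Primrec.fst.comp Primrec.snd
  have hw : Primrec fun p : (List ℕ × List (ℕ × α)) × ℕ × α => p.2.2 :=
    Primrec.snd.comp Primrec.snd
  have hmem : PrimrecPred fun p : (List ℕ × List (ℕ × α)) × ℕ × α => p.2.1 ∈ p.1.1 :=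
    (PrimrecPred.exists_mem_comp (P := fun p l => p.2.1 = l) hK
      (Primrec.eq.comp (hk.comp Primrec.fst) Primrec.snd)).of_eq fun p => by simp
  refine Primrec.pair ?_ (Primrec.list_cons.comp (hk.pair hw) (Primrec.snd.comp Primrec.fst))
  exact Primrec.ite (hmem.or (hle.comp hw (Primrec.const _))) hK
    (Primrec.list_concat.comp hK hk)

theorem exists_computable_run (hle : PrimrecRel fun c d : α => c ≤ d)
    (hgood : PrimrecPred S.good) (ha : Primrec₂ S.a) :
    ∃ (v : ℕ → ℕ → α) (K : ℕ → List ℕ), S.Run v K ∧ Computable₂ v ∧ Computable K := by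
  have hnext : PrimrecRel fun (b : (List ℕ × List (ℕ × α)) × ℕ) (w : α) =>
      S.Next b.1.1 (S.logValue b.1.2) b.2.unpair.1 b.2 w :=
    S.primrecPred_next hle hgood ha (Primrec.fst.comp (Primrec.fst.comp Primrec.fst))
      (Primrec.snd.comp (Primrec.fst.comp Primrec.fst))
      (Primrec.fst.comp (Primrec.unpair.comp (Primrec.snd.comp Primrec.fst)))
      (Primrec.snd.comp Primrec.fst) Primrec.snd
  have : Nonempty α := ⟨S.bot⟩
  obtain ⟨f, hf, hfs⟩ := Computable.exists_choice hnext fun b => S.exists_next _ _ _ _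
  -- The state is the list of opened slots and a log with the newest entry first, so that lookup
  -- returns the current value.
  let σ : ℕ → List ℕ × List (ℕ × α) := fun s => Nat.rec ([], [])
    (fun s τ => S.record τ s.unpair.1 (f (τ, s))) s
  have hσ : Computable σ := by
    have hs : Computable fun p : ℕ × ℕ × List ℕ × List (ℕ × α) => p.2.1 :=
      Computable.fst.comp Computable.snd
    have hτ : Computable fun p : ℕ × ℕ × List ℕ × List (ℕ × α) => p.2.2 :=
      Computable.snd.comp Computable.snd
    have hk : Computable fun p : ℕ × ℕ × List ℕ × List (ℕ × α) => p.2.1.unpair.1 :=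
      Computable.fst.comp (Computable.unpair.comp hs)
    have harg : Computable fun p : ℕ × ℕ × List ℕ × List (ℕ × α) =>
        (p.2.2, p.2.1.unpair.1, f (p.2.2, p.2.1)) :=
      hτ.pair (hk.pair (hf.comp (hτ.pair hs)))
    have hstep : Computable fun p : ℕ × ℕ × List ℕ × List (ℕ × α) =>
        S.record p.2.2 p.2.1.unpair.1 (f (p.2.2, p.2.1)) :=
      ((S.primrec_record hle).to_comp.comp harg).of_eq fun _ => rfl
    exact Computable.nat_rec Computable.id (Computable.const ([], [])) hstep.to₂
  have hsucc : ∀ s, σ (s + 1) = S.record (σ s) s.unpair.1 (f (σ s, s)) := fun s => rfl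
  have hself : ∀ s, S.logValue (σ (s + 1)).2 s.unpair.1 = f (σ s, s) := fun s => by
    rw [hsucc]
    simp [record, logValue]
  refine ⟨fun s k => S.logValue (σ s).2 k, fun s => (σ s).1, ⟨?_, rfl, ?_, ?_, ?_, ?_⟩, ?_, ?_⟩
  · exact fun k => rfl
  · intro s
    show S.Next _ _ _ _ (S.logValue (σ (s + 1)).2 s.unpair.1)
    rw [hself]
    exact hfs (σ s, s)
  · intro s k hk
    show S.logValue (σ (s + 1)).2 k = _
    rw [hsucc]
    have : (k == s.unpair.1) = false := by simpa using hk
    simp [record, logValue, List.lookup_cons, this]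
  · intro s h
    replace h : s.unpair.1 ∈ (σ s).1 ∨ S.logValue (σ (s + 1)).2 s.unpair.1 ≤ S.bot := h
    rw [hself] at h
    show (σ (s + 1)).1 = _
    rw [hsucc, record, if_pos h]
  · intro s h h'
    replace h' : ¬ S.logValue (σ (s + 1)).2 s.unpair.1 ≤ S.bot := h'
    rw [hself] at h'
    show (σ (s + 1)).1 = _
    rw [hsucc, record, if_neg (not_or.2 ⟨h, h'⟩)]
  · exact S.primrec_logValue.to_comp.comp (Computable.snd.comp (hσ.comp Computable.fst))
      Computable.snd
  · exact Computable.fst.comp hσ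

theorem computable_slotValue {v : ℕ → ℕ → α} {K : ℕ → List ℕ} (hv : Computable₂ v)
    (hK : Computable K) : Computable₂ (S.slotValue v K) := by
  refine Computable.option_getD (Computable.option_map ?_ ?_) (Computable.const _)
  · exact Computable.list_getElem?.comp (hK.comp Computable.snd) Computable.fst
  · exact hv.comp (Computable.snd.comp Computable.fst) Computable.snd

/-- The limits of an approximation system can be enumerated without repetition. -/
theorem exists_injective (hle : PrimrecRel fun c d : α => c ≤ d)
    (hgood : PrimrecPred S.good) (ha : Primrec₂ S.a) :
    ∃ g : ℕ → ℕ → α, Computable₂ g ∧ (∀ x, ∃ i, Cofinal (g x) (S.a i)) ∧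
      (∀ x, ∃ s, ¬ g x s ≤ S.bot) ∧
      (∀ i, (∃ s, ¬ S.a i s ≤ S.bot) → ∃ x, Cofinal (g x) (S.a i)) ∧
      ∀ x y, Cofinal (g x) (g y) → x = y := by
  obtain ⟨v, K, R, hv, hK⟩ := S.exists_computable_run hle hgood ha
  exact ⟨S.slotValue v K, S.computable_slotValue hv hK, R.slotValue_mem,
    R.slotValue_not_le_bot, fun i => R.exists_cofinal_slotValue,
    fun x y => R.slotValue_injective⟩

end ApproxSystem

/-! ### Enumerable predicates and their stages -/

theorem REPred.exists_of_computablePred {β : Type*} [Primcodable β] {P : β → ℕ → Prop}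
    (hP : ComputablePred fun p : β × ℕ => P p.1 p.2) : REPred fun b => ∃ s, P b s := by
  classical
  have h : Partrec fun b => Nat.rfind fun s => Part.some (decide (P b s)) :=
    Partrec.rfind hP.decide.partrec
  refine h.dom_re.of_eq fun b => ?_
  refine Nat.rfind_dom.trans ⟨?_, ?_⟩
  · rintro ⟨s, hs, -⟩
    exact ⟨s, by simpa using hs⟩
  · rintro ⟨s, hs⟩
    exact ⟨s, by simpa using hs, fun _ => trivial⟩

theorem REPred.exists_primrec {β : Type*} [Primcodable β] {p : β → Prop} (hp : REPred p) :
    ∃ S : β → ℕ → Bool, Primrec₂ S ∧ ∀ b, p b ↔ ∃ s, S b s = true := by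
  obtain ⟨c, hc⟩ := Nat.Partrec.Code.exists_code.1 hp
  refine ⟨fun b s => (Nat.Partrec.Code.evaln s c (Encodable.encode b)).isSome, ?_, fun b => ?_⟩
  · exact Primrec.option_isSome.comp (Nat.Partrec.Code.primrec_evaln.comp
      ((Primrec.snd.pair (Primrec.const c)).pair (Primrec.encode.comp Primrec.fst)))
  · have h1 : p b ↔ (Nat.Partrec.Code.eval c (Encodable.encode b)).Dom := by
      rw [hc]
      simp only [Encodable.encodek, Part.coe_some, Part.bind_some]
      exact ⟨fun h => ⟨h, trivial⟩, fun h => h.1⟩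
    rw [h1, Part.dom_iff_mem]
    simp only [Nat.Partrec.Code.evaln_complete, Option.isSome_iff_exists, Option.mem_def]
    exact exists_comm

/-! ### Cones and optimal coverings -/

section Cone

theorem length_initSeg (X : ℕ → Bool) (n : ℕ) : (initSeg X n).length = n := by simp [initSeg]

theorem getElem?_initSeg (X : ℕ → Bool) {n k : ℕ} (h : k < n) : (initSeg X n)[k]? = some (X k) := by
  simp [initSeg, h]

theorem mem_cone_iff {X : ℕ → Bool} {σ : List Bool} :
    X ∈ cone σ ↔ ∀ k < σ.length, σ[k]? = some (X k) := by
  constructor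
  · intro h k hk
    have h' : initSeg X σ.length = σ := h
    rw [← h', getElem?_initSeg X hk]
  · intro h
    refine List.ext_getElem? fun k => ?_
    by_cases hk : k < σ.length
    · rw [h k hk, getElem?_initSeg X hk]
    · rw [List.getElem?_eq_none (by rw [length_initSeg]; omega),
        List.getElem?_eq_none (by omega)]

theorem mem_cone_initSeg (X : ℕ → Bool) (n : ℕ) : X ∈ cone (initSeg X n) := by
  show initSeg X (initSeg X n).length = _
  rw [length_initSeg]

theorem cone_anti {σ τ : List Bool} (h : σ <+: τ) : cone τ ⊆ cone σ := by
  intro X hX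
  rw [mem_cone_iff] at hX ⊢
  intro k hk
  rw [← hX k (hk.trans_le h.length_le)]
  exact (List.getElem?_eq_getElem hk).trans (List.prefix_iff_getElem?.1 h k hk).symm

theorem prefix_of_mem_cone {X : ℕ → Bool} {σ τ : List Bool} (hσ : X ∈ cone σ) (hτ : X ∈ cone τ)
    (h : σ.length ≤ τ.length) : σ <+: τ := by
  rw [List.prefix_iff_getElem?]
  intro k hk
  rw [mem_cone_iff.1 hτ k (hk.trans_le h), ← mem_cone_iff.1 hσ k hk, List.getElem?_eq_getElem hk]

/-- The sequence extending `σ` by zeros. -/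
def zeroExt (σ : List Bool) : ℕ → Bool := fun k => (σ[k]?).getD false

theorem zeroExt_mem (σ : List Bool) : zeroExt σ ∈ cone σ := by
  rw [mem_cone_iff]
  intro k hk
  simp [zeroExt, hk]

theorem isClopen_cone (σ : List Bool) : IsClopen (cone σ) := by
  have h : cone σ = ⋂ k ∈ Set.Iio σ.length, (fun X : ℕ → Bool => X k) ⁻¹' {b | σ[k]? = some b} := by
    ext X
    simp [mem_cone_iff]
  rw [h]
  exact (Set.finite_Iio _).isClopen_biInter fun k _ =>
    (isClopen_discrete _).preimage (continuous_apply k)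

theorem openClass_optimalCovering (S : Set (List Bool)) :
    openClass (optimalCovering S) = openClass S := by
  classical
  apply Set.Subset.antisymm
  · exact Set.iUnion₂_subset fun σ hσ => hσ.1
  · intro X hX
    obtain ⟨σ, hσ, hXσ⟩ := Set.mem_iUnion₂.1 hX
    -- The shortest initial segment of `X` with covered cone belongs to the optimal covering.
    have hex : ∃ n, cone (initSeg X n) ⊆ openClass S :=
      ⟨σ.length, by
        rw [show initSeg X σ.length = σ from hXσ]
        exact Set.subset_biUnion_of_mem (u := cone) hσ⟩
    refine Set.mem_iUnion₂.2 ⟨initSeg X (Nat.find hex), ⟨Nat.find_spec hex, ?_⟩,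
      mem_cone_initSeg X _⟩
    rintro ⟨τ, hτ, hne, hsub⟩
    have hX' : X ∈ cone τ := cone_anti hτ (mem_cone_initSeg X _)
    have hlt : τ.length < Nat.find hex := by
      have hle := hτ.length_le
      rw [length_initSeg] at hle
      refine lt_of_le_of_ne hle fun h => hne (hτ.eq_of_length ?_)
      rw [length_initSeg, h]
    refine Nat.find_min hex hlt ?_
    rwa [show initSeg X τ.length = τ from hX']

end Cone

/-! ### Clopen codes and decidability of inclusion -/

/-- Codes of clopen classes: finite lists of strings. -/
def ClopenCode : Type := List (List Bool)

namespace ClopenCode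

instance : Primcodable ClopenCode := inferInstanceAs (Primcodable (List (List Bool)))

/-- The clopen class with code `c`. -/
def toClass : ClopenCode → Set (ℕ → Bool) := fun c : List (List Bool) => openClass {σ | σ ∈ c}

/-- Codes are preordered by inclusion of the clopen classes. -/
instance : Preorder ClopenCode := Preorder.lift toClass

theorem le_iff {c d : ClopenCode} : c ≤ d ↔ c.toClass ⊆ d.toClass := Iff.rfl

theorem mem_toClass {c : List (List Bool)} {X : ℕ → Bool} :
    X ∈ toClass c ↔ ∃ σ ∈ c, X ∈ cone σ := by
  simp [toClass, openClass]

/-- All strings of length `n`. -/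
def strings (n : ℕ) : List (List Bool) :=
  Nat.rec [[]] (fun _ L => L.map (List.cons false) ++ L.map (List.cons true)) n

theorem mem_strings {n : ℕ} {u : List Bool} : u ∈ strings n ↔ u.length = n := by
  induction n generalizing u with
  | zero => simp [strings]
  | succ n ih =>
    have h : strings (n + 1) =
      (strings n).map (List.cons false) ++ (strings n).map (List.cons true) := rfl
    rw [h]
    cases u with
    | nil => simp
    | cons b u => cases b <;> simp [ih]

theorem primrec_strings : Primrec strings := by
  refine Primrec.nat_rec₁ _ ?_
  have h : ∀ b : Bool, Primrec fun p : ℕ × List (List Bool) => p.2.map (List.cons b) := fun b =>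
    Primrec.list_map Primrec.snd (Primrec.list_cons.comp (Primrec.const b) Primrec.snd)
  exact Primrec.list_append.comp (h false) (h true)

theorem primrecRel_prefix : PrimrecRel fun σ τ : List Bool => σ <+: τ :=
  (Primrec.eq.comp Primrec.fst (Primrec.list_take.comp (Primrec.list_length.comp Primrec.fst)
    Primrec.snd)).of_eq fun _ => List.prefix_iff_eq_take.symm

theorem primrecRel_hit : PrimrecRel fun (σ : List Bool) (c : List (List Bool)) =>
    ∃ τ ∈ c, τ <+: σ :=
  PrimrecPred.exists_mem_comp Primrec.snd
    (primrecRel_prefix.comp Primrec.snd (Primrec.fst.comp Primrec.fst))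

theorem length_le_of_mem {c : List (List Bool)} {σ : List Bool} (h : σ ∈ c) :
    σ.length ≤ c.flatten.length := (List.sublist_flatten_of_mem h).length_le

theorem hit_of_mem {c : List (List Bool)} {X : ℕ → Bool} {σ : List Bool} (hX : X ∈ toClass c)
    (hσ : X ∈ cone σ) (h : c.flatten.length ≤ σ.length) : ∃ τ ∈ c, τ <+: σ := by
  obtain ⟨τ, hτ, hXτ⟩ := mem_toClass.1 hX
  exact ⟨τ, hτ, prefix_of_mem_cone hXτ hσ ((length_le_of_mem hτ).trans h)⟩

/-- The total length of `c` bounds the length of each of its strings, so extensions by that many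
bits already decide membership. -/
theorem cone_subset_iff {σ : List Bool} {c : List (List Bool)} :
    cone σ ⊆ toClass c ↔ ∀ u ∈ strings c.flatten.length, ∃ τ ∈ c, τ <+: σ ++ u := by
  constructor
  · intro h u hu
    rw [mem_strings] at hu
    have hX := zeroExt_mem (σ ++ u)
    exact hit_of_mem (h (cone_anti (List.prefix_append σ u) hX)) hX (by simp [hu])
  · intro h X hX
    set N := c.flatten.length
    have hpre : σ <+: initSeg X (σ.length + N) :=
      prefix_of_mem_cone hX (mem_cone_initSeg X _) (by simp [length_initSeg])
    obtain ⟨u, hu⟩ := hpre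
    have hlen : u.length = N := by
      have := congrArg List.length hu
      rw [List.length_append, length_initSeg] at this
      omega
    obtain ⟨τ, hτ, hp⟩ := h u (mem_strings.2 hlen)
    rw [hu] at hp
    exact mem_toClass.2 ⟨τ, hτ, cone_anti hp (mem_cone_initSeg X _)⟩

theorem primrecRel_cone_subset : PrimrecRel fun (σ : List Bool) (c : List (List Bool)) =>
    cone σ ⊆ toClass c := by
  have h : PrimrecRel fun (u : List Bool) (p : List Bool × List (List Bool)) =>
      ∃ τ ∈ p.2, τ <+: p.1 ++ u :=
    primrecRel_hit.comp (Primrec.list_append.comp (Primrec.fst.comp Primrec.snd) Primrec.fst)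
      (Primrec.snd.comp Primrec.snd)
  exact (h.forall_mem_list.comp (primrec_strings.comp (Primrec.list_length.comp
    (Primrec.list_flatten.comp Primrec.snd))) Primrec.id).of_eq fun _ => cone_subset_iff.symm

theorem le_iff_cone {c d : List (List Bool)} :
    (LE.le (α := ClopenCode) c d) ↔ ∀ σ ∈ c, cone σ ⊆ toClass d := by
  refine le_iff.trans ⟨fun h σ hσ X hX => h (mem_toClass.2 ⟨σ, hσ, hX⟩), fun h X hX => ?_⟩
  obtain ⟨σ, hσ, hXσ⟩ := mem_toClass.1 hX
  exact h σ hσ hXσ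

theorem primrecRel_le : PrimrecRel fun c d : ClopenCode => c ≤ d :=
  PrimrecRel.of_eq (primrecRel_cone_subset.forall_mem_list) fun _ _ => le_iff_cone.symm

/-- The list enumerates the optimal covering of its class without repetition. -/
def Reduced (c : List (List Bool)) : Prop :=
  c.Nodup ∧ ∀ σ ∈ c, σ = [] ∨ ¬ cone σ.dropLast ⊆ toClass c

/-- Reduced codes of odd length. -/
def Good (c : ClopenCode) : Prop := Odd (List.length c) ∧ Reduced c

theorem primrecPred_nodup {β : Type*} [Primcodable β] :
    PrimrecPred fun l : List β => l.Nodup := by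
  have h : PrimrecPred fun l : List β => ∀ j < l.length, ∀ i < j, l[i]? ≠ l[j]? := by
    refine PrimrecPred.forall_lt_comp Primrec.list_length
      (PrimrecPred.forall_lt_comp Primrec.snd (Primrec.eq.comp ?_ ?_).not)
    · exact Primrec.list_getElem?.comp (Primrec.fst.comp Primrec.fst) Primrec.snd
    · exact Primrec.list_getElem?.comp (Primrec.fst.comp Primrec.fst)
        (Primrec.snd.comp Primrec.fst)
  refine h.of_eq fun l => ?_
  rw [List.nodup_iff_getElem?_ne_getElem?]
  exact ⟨fun h i j hij hj => h j hj i hij, fun h j hj i hij => h i j hij hj⟩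

theorem primrecPred_good : PrimrecPred Good := by
  have hodd : PrimrecPred fun c : List (List Bool) => Odd c.length :=
    (Primrec.eq.comp (Primrec.nat_mod.comp Primrec.list_length (Primrec.const 2))
      (Primrec.const 1)).of_eq fun c => Nat.odd_iff.symm
  have hdrop : Primrec (List.dropLast : List Bool → List Bool) :=
    (Primrec.list_take.comp (Primrec.nat_sub.comp Primrec.list_length (Primrec.const 1))
      Primrec.id).of_eq fun l => List.dropLast_eq_take.symm
  have h : PrimrecRel fun (σ : List Bool) (c : List (List Bool)) =>
      σ = [] ∨ ¬ cone σ.dropLast ⊆ toClass c :=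
    (Primrec.eq.comp Primrec.fst (Primrec.const [])).or
      (primrecRel_cone_subset.comp (hdrop.comp Primrec.fst) Primrec.snd).not
  exact hodd.and (primrecPred_nodup.and (h.forall_mem_list.comp Primrec.id Primrec.id))

theorem cone_dropLast_subset {σ τ : List Bool} (h : τ <+: σ) (hne : τ ≠ σ) :
    cone σ.dropLast ⊆ cone τ := by
  refine cone_anti ?_
  obtain ⟨u, rfl⟩ := h
  have hu : u ≠ [] := fun h => hne (by simp [h])
  rw [List.dropLast_append_of_ne_nil hu]
  exact List.prefix_append _ _

/-- Testing `dropLast` suffices: every proper prefix has a cone containing that of `dropLast`. -/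
theorem Reduced.optimalCovering_eq {c : List (List Bool)} (h : Reduced c) :
    optimalCovering {σ | σ ∈ c} = {σ | σ ∈ c} := by
  have hmem : ∀ σ ∈ c, cone σ ⊆ toClass c := fun σ hσ X hX => mem_toClass.2 ⟨σ, hσ, hX⟩
  ext σ
  constructor
  · rintro ⟨h1, h2⟩
    obtain ⟨τ, hτ, hX⟩ := mem_toClass.1 (h1 (zeroExt_mem σ))
    rcases le_total τ.length σ.length with hl | hl
    · have hp := prefix_of_mem_cone hX (zeroExt_mem σ) hl
      by_cases he : τ = σ
      · exact he ▸ hτ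
      · exact (h2 ⟨τ, hp, he, hmem τ hτ⟩).elim
    · have hp := prefix_of_mem_cone (zeroExt_mem σ) hX hl
      by_cases he : σ = τ
      · exact he ▸ hτ
      · rcases h.2 τ hτ with h3 | h3
        · exact (he (by subst h3; exact List.prefix_nil.1 hp)).elim
        · exact (h3 ((cone_dropLast_subset hp he).trans h1)).elim
  · intro hσ
    refine ⟨hmem σ hσ, ?_⟩
    rintro ⟨τ, hp, hne, hsub⟩
    rcases h.2 σ hσ with h3 | h3
    · subst h3
      exact hne (List.prefix_nil.1 hp)
    · exact h3 ((cone_dropLast_subset hp hne).trans hsub)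

theorem Good.toClass_mem {c : List (List Bool)} (h : Good c) :
    ∃ O ∈ oddOptimalCoverings, toClass c = openClass O := by
  classical
  have hfin : {σ | σ ∈ c} =
      ((c.toFinset : Finset (List Bool)) : Set (List Bool)) := by
    ext; simp
  refine ⟨_, ⟨⟨_, h.2.optimalCovering_eq.symm⟩, ?_, ?_⟩, rfl⟩
  · rw [hfin]; exact Finset.finite_toSet _
  · rw [hfin, Set.ncard_coe_finset, List.toFinset_card_of_nodup h.2.1]
    exact h.1

/-! ### Density of the odd classes -/

theorem exists_reduced (c : List (List Bool)) : ∃ d : List (List Bool), Reduced d ∧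
    toClass d = toClass c := by
  set M := optimalCovering {σ | σ ∈ c}
  have hM : openClass M = toClass c := openClass_optimalCovering _
  have hfin : M.Finite := by
    -- A string longer than the bound has a member of `c` as a proper prefix, so it is not minimal.
    refine (List.finite_length_le Bool
      c.flatten.length).subset fun σ hσ => ?_
    by_contra hlt
    replace hlt : c.flatten.length < σ.length := not_le.1 hlt
    obtain ⟨τ, hτ, hp⟩ := hit_of_mem (hσ.1 (zeroExt_mem σ)) (zeroExt_mem σ) hlt.le
    refine hσ.2 ⟨τ, hp, fun he => ?_, fun X hX => mem_toClass.2 ⟨τ, hτ, hX⟩⟩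
    have := length_le_of_mem hτ
    rw [he] at this
    omega
  have hd : toClass hfin.toFinset.toList = toClass c := by
    rw [← hM]
    simp [toClass]
  refine ⟨hfin.toFinset.toList, ⟨Finset.nodup_toList _, fun σ hσ => ?_⟩, hd⟩
  rw [hd, or_iff_not_imp_left]
  intro hne hsub
  have hσ' : σ ∈ M := by simpa using hσ
  refine hσ'.2 ⟨σ.dropLast, List.dropLast_prefix σ, fun he => ?_, hsub⟩
  have h1 := congrArg List.length he
  rw [List.length_dropLast] at h1
  have h2 := List.length_pos_iff.2 hne
  omega

theorem toClass_concat (c : List (List Bool)) (σ : List Bool) :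
    toClass (c ++ [σ]) = toClass c ∪ cone σ := by
  ext X
  simp only [Set.mem_union, mem_toClass]
  simp [or_and_right, exists_or]

theorem not_mem_cone_append {X : ℕ → Bool} {σ : List Bool} {b : Bool}
    (h : X ∈ cone (σ ++ [b])) : X ∉ cone (σ ++ [!b]) := by
  intro h'
  have h1 := mem_cone_iff.1 h σ.length (by simp)
  have h2 := mem_cone_iff.1 h' σ.length (by simp)
  simp at h1 h2
  rw [← h1] at h2
  simp at h2

/-- The sibling `σ ++ [!b]` stays uncovered, so the new string merges with nothing and the optimal
covering grows by exactly one. -/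
theorem Reduced.concat {c : List (List Bool)} (h : Reduced c) {σ : List Bool}
    (hd : Disjoint (cone σ) (toClass c)) (b : Bool) : Reduced (c ++ [σ ++ [b]]) := by
  have hsub : cone (σ ++ [b]) ⊆ cone σ := cone_anti (List.prefix_append _ _)
  have hdisj : ∀ X ∈ cone σ, X ∉ toClass c := fun X hX hX' =>
    Set.disjoint_left.1 hd hX hX'
  have hother : ∃ X ∈ cone σ, X ∉ toClass (c ++ [σ ++ [b]]) := by
    refine ⟨zeroExt (σ ++ [!b]), ?_, ?_⟩
    · exact cone_anti (List.prefix_append _ _) (zeroExt_mem _)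
    · rw [toClass_concat]
      rintro (h1 | h1)
      · exact hdisj _ (cone_anti (List.prefix_append _ _) (zeroExt_mem _)) h1
      · exact not_mem_cone_append h1 (zeroExt_mem _)
  obtain ⟨Y, hY, hYn⟩ := hother
  refine ⟨?_, fun τ hτ => ?_⟩
  · rw [List.nodup_append]
    refine ⟨h.1, by simp, ?_⟩
    intro x hx y hy hxy
    rw [List.mem_singleton] at hy
    refine hdisj _ (hsub (zeroExt_mem _)) (mem_toClass.2 ⟨x, hx, ?_⟩)
    rw [hxy, hy]
    exact zeroExt_mem _
  · rw [List.mem_append, List.mem_singleton] at hτ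
    rcases hτ with hτ | rfl
    · refine (h.2 τ hτ).imp_right fun h1 h2 => h1 fun X hX => ?_
      rcases (toClass_concat c (σ ++ [b]) ▸ h2 hX : X ∈ toClass c ∪ cone (σ ++ [b])) with h3 | h3
      · exact h3
      have hXσ := hsub h3
      exfalso
      -- Either `τ` extends `σ`, against disjointness, or `τ.dropLast` is a prefix of `σ` and its
      -- cone contains the uncovered `Y`.
      rcases le_total σ.length τ.dropLast.length with hl | hl
      · have hp := (prefix_of_mem_cone hXσ hX hl).trans (List.dropLast_prefix τ)
        exact hdisj _ (cone_anti hp (zeroExt_mem τ)) (mem_toClass.2 ⟨τ, hτ, zeroExt_mem τ⟩)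
      · have hp := prefix_of_mem_cone hX hXσ hl
        exact hYn (h2 (cone_anti hp hY))
    · right
      rw [List.dropLast_concat]
      exact fun h1 => hYn (h1 hY)

theorem isClopen_toClass (c : List (List Bool)) : IsClopen (toClass c) := by
  have h : toClass c = ⋃ σ ∈ c.toFinset, cone σ := by
    ext X
    simp [mem_toClass]
  rw [h]
  exact c.toFinset.finite_toSet.isClopen_biUnion fun σ _ => isClopen_cone σ

theorem exists_le_of_subset_iUnion {c : ClopenCode} {f : ℕ → ClopenCode} (hf : Monotone f)
    (h : c.toClass ⊆ ⋃ s, (f s).toClass) : ∃ s, c ≤ f s :=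
  (isClopen_toClass c).isClosed.isCompact.elim_directed_cover _
    (fun s => (isClopen_toClass (f s)).isOpen) h
    (directed_of_isDirected_le fun _ _ hst => le_iff.1 (hf hst))

theorem iUnion_eq_of_cofinal {f g : ℕ → ClopenCode} (h : Cofinal f g) :
    ⋃ s, (f s).toClass = ⋃ s, (g s).toClass := by
  apply Set.Subset.antisymm
  · refine Set.iUnion_subset fun s => ?_
    obtain ⟨t, ht⟩ := h.1 s
    exact (le_iff.1 ht).trans (Set.subset_iUnion (fun t => (g t).toClass) t)
  · refine Set.iUnion_subset fun s => ?_
    obtain ⟨t, ht⟩ := h.2 s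
    exact (le_iff.1 ht).trans (Set.subset_iUnion (fun t => (f t).toClass) t)

theorem cofinal_of_iUnion_eq {f g : ℕ → ClopenCode} (hf : Monotone f) (hg : Monotone g)
    (h : ⋃ s, (f s).toClass = ⋃ s, (g s).toClass) : Cofinal f g :=
  ⟨fun s => exists_le_of_subset_iUnion hg (h ▸ Set.subset_iUnion (fun t => (f t).toClass) s),
    fun s => exists_le_of_subset_iUnion hf (h ▸ Set.subset_iUnion (fun t => (g t).toClass) s)⟩

theorem exists_cone_of_not_le {d e : List (List Bool)} (h : ¬ toClass e ⊆ toClass d) :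
    ∃ σ, cone σ ⊆ toClass e ∧ Disjoint (cone σ) (toClass d) := by
  obtain ⟨X, hXe, hXd⟩ := Set.not_subset.1 h
  obtain ⟨τ, hτ, hXτ⟩ := mem_toClass.1 hXe
  set n := max τ.length d.flatten.length
  have hX := mem_cone_initSeg X n
  refine ⟨initSeg X n, fun Y hY => mem_toClass.2 ⟨τ, hτ, ?_⟩, Set.disjoint_left.2 ?_⟩
  · refine cone_anti (prefix_of_mem_cone hXτ hX ?_) hY
    rw [length_initSeg]
    exact le_max_left _ _
  · intro Y hY hYd
    obtain ⟨ρ, hρ, hp⟩ := hit_of_mem hYd hY (by rw [length_initSeg]; exact le_max_right _ _)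
    exact hXd (mem_toClass.2 ⟨ρ, hρ, cone_anti hp hX⟩)

theorem disjoint_branches (σ : List Bool) {m n : ℕ} (h : m < n) :
    Disjoint (cone (σ ++ List.replicate m false ++ [true]))
      (cone (σ ++ List.replicate n false ++ [true])) := by
  refine Set.disjoint_left.2 fun X hm hn => ?_
  refine not_mem_cone_append (b := true) hm (cone_anti ?_ hn)
  obtain ⟨k, rfl⟩ := Nat.exists_eq_add_of_lt h
  refine ⟨List.replicate k false ++ [true], ?_⟩
  simp [add_assoc, List.replicate_add, List.replicate_succ]

/-- If the reduced code of `d` has odd length, half of a cone in the gap is spent to correct the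
parity; the other half remains free. -/
theorem exists_even_reduced {d e : List (List Bool)} (hde : toClass d ⊆ toClass e)
    (h : ¬ toClass e ⊆ toClass d) : ∃ (c : List (List Bool)) (σ : List Bool),
      Reduced c ∧ Even c.length ∧ toClass d ⊆ toClass c ∧ toClass c ⊆ toClass e ∧
      cone σ ⊆ toClass e ∧ Disjoint (cone σ) (toClass c) := by
  obtain ⟨σ, hσe, hσd⟩ := exists_cone_of_not_le h
  obtain ⟨c, hc, hcd⟩ := exists_reduced d
  have hsub : ∀ b, cone (σ ++ [b]) ⊆ cone σ := fun b => cone_anti (List.prefix_append _ _)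
  rcases Nat.even_or_odd c.length with hpar | hpar
  · exact ⟨c, σ, hc, hpar, hcd.ge, hcd.le.trans hde, hσe, hcd ▸ hσd⟩
  · refine ⟨c ++ [σ ++ [false]], σ ++ [true], hc.concat (hcd ▸ hσd) false, ?_, ?_, ?_,
      (hsub true).trans hσe, ?_⟩
    · rw [List.length_append]
      exact hpar.add_odd odd_one
    · rw [toClass_concat, hcd]
      exact Set.subset_union_left
    · rw [toClass_concat, hcd]
      exact Set.union_subset hde ((hsub false).trans hσe)
    · rw [toClass_concat, hcd, Set.disjoint_union_right]
      exact ⟨hσd.mono_left (hsub true), Set.disjoint_left.2 fun X h1 h2 =>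
        not_mem_cone_append h1 h2⟩

/-- Adding a single string `σ 0^m 1` inside the free cone makes the length odd. Different `m` give
disjoint additions, so infinitely many classes arise and some `m` avoids the finite list. -/
theorem exists_good_between {d e : ClopenCode} (hde : d ≤ e) (h : ¬ e ≤ d)
    (T : List ClopenCode) : ∃ c, Good c ∧ d ≤ c ∧ c ≤ e ∧ ∀ x ∈ T, ¬ Equi c x := by
  obtain ⟨c, σ, hc, hpar, hdc, hce, hσe, hσc⟩ := exists_even_reduced hde h
  let τ : ℕ → List Bool := fun m => σ ++ List.replicate m false
  have hτ : ∀ m, cone (τ m) ⊆ cone σ := fun m => cone_anti (List.prefix_append _ _)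
  have hτ' : ∀ m, cone (τ m ++ [true]) ⊆ cone σ := fun m =>
    (cone_anti (List.prefix_append _ _)).trans (hτ m)
  let f : ℕ → ClopenCode := fun m => (c ++ [τ m ++ [true]] : List (List Bool))
  have hf : ∀ m, (f m).toClass = toClass c ∪ cone (τ m ++ [true]) := fun m => toClass_concat _ _
  have hgood : ∀ m, Good (f m) := fun m =>
    ⟨by
      show Odd (c ++ [τ m ++ [true]]).length
      rw [List.length_append]
      exact hpar.add_odd odd_one, hc.concat (hσc.mono_left (hτ m)) true⟩
  have hne : ∀ m n, m ≠ n → ¬ Equi (f m) (f n) := by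
    intro m n hmn heq
    have h1 : zeroExt (τ m ++ [true]) ∈ (f n).toClass :=
      le_iff.1 heq.1 ((hf m).ge (Or.inr (zeroExt_mem _)))
    rcases (hf n).le h1 with h2 | h2
    · exact Set.disjoint_left.1 hσc (hτ' m (zeroExt_mem _)) h2
    · rcases hmn.lt_or_gt with h3 | h3
      · exact Set.disjoint_left.1 (disjoint_branches σ h3) (zeroExt_mem _) h2
      · exact Set.disjoint_left.1 (disjoint_branches σ h3) h2 (zeroExt_mem _)
  have hex : ∃ m, ∀ x ∈ T, ¬ Equi (f m) x := by
    by_contra hcon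
    push Not at hcon
    choose g hg using hcon
    have : Finite {x // x ∈ T} := (List.finite_toSet T).to_subtype
    obtain ⟨m, n, hmn, he⟩ := Finite.exists_ne_map_eq_of_infinite
      fun m => (⟨g m, (hg m).1⟩ : {x // x ∈ T})
    have he' : g m = g n := congrArg Subtype.val he
    exact hne m n hmn ((hg m).2.trans (he' ▸ (hg n).2.symm))
  obtain ⟨m, hm⟩ := hex
  refine ⟨f m, hgood m, ?_, ?_, hm⟩
  · rw [le_iff, hf]
    exact hdc.trans Set.subset_union_left
  · rw [le_iff, hf]
    exact Set.union_subset hce ((hτ' m).trans hσe)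

/-! ### Numberings as arrays of clopen approximations -/

theorem isSigma01_iUnion {g : ℕ → ℕ → ClopenCode} (hg : Computable₂ g) :
    IsSigma01 fun X e => X ∈ ⋃ s, (g e s).toClass := by
  classical
  let P : List Bool × ℕ → ℕ → Prop := fun p s =>
    ∃ τ ∈ (show List (List Bool) from g p.2 s), τ <+: p.1
  refine ⟨fun p => ∃ s, P p s, REPred.exists_of_computablePred ?_, fun X e => ?_⟩
  · refine Computable.computablePred (Computable.of_eq (primrecRel_hit.decide.to_comp.comp
      (Computable.fst.comp Computable.fst)
      (hg.comp (Computable.snd.comp Computable.fst) Computable.snd)) fun p => rfl)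
  · constructor
    · intro h
      obtain ⟨s, hs⟩ := Set.mem_iUnion.1 h
      obtain ⟨τ, hτ, hX⟩ := mem_toClass.1 hs
      exact ⟨τ.length, s, τ, hτ, by rw [show initSeg X τ.length = τ from hX]⟩
    · rintro ⟨n, s, τ, hτ, hp⟩
      exact Set.mem_iUnion.2 ⟨s, mem_toClass.2 ⟨τ, hτ, cone_anti hp (mem_cone_initSeg X n)⟩⟩

theorem exists_primrec_approximation {ψ : ℕ → Set (ℕ → Bool)}
    (h : IsSigma01 fun X e => X ∈ ψ e) :
    ∃ a : ℕ → ℕ → ClopenCode, Primrec₂ a ∧ (∀ i, Monotone (a i)) ∧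
      (∀ i, (a i 0).toClass = ∅) ∧ ∀ i, ψ i = ⋃ s, (a i s).toClass := by
  obtain ⟨W, hW, hψ⟩ := h
  obtain ⟨S, hS, hWS⟩ := REPred.exists_primrec hW
  -- The number `t` codes a string together with a stage at which it may be enumerated, which keeps
  -- the approximation primitive recursive.
  let e : ℕ → ℕ → Option (List Bool) := fun i t =>
    (Encodable.decode t.unpair.1 : Option (List Bool)).bind fun σ =>
      if S (σ, i) t.unpair.2 = true then some σ else none
  have he : ∀ i t σ, e i t = some σ ↔
      Encodable.decode t.unpair.1 = some σ ∧ S (σ, i) t.unpair.2 = true := by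
    intro i t σ
    simp only [e, Option.bind_eq_some_iff]
    constructor
    · rintro ⟨τ, h1, h2⟩
      split_ifs at h2 with h3
      rw [Option.some.injEq] at h2
      exact h2 ▸ ⟨h1, h3⟩
    · rintro ⟨h1, h2⟩
      exact ⟨σ, h1, by simp [h2]⟩
  have hep : Primrec₂ e := by
    refine Primrec.option_bind (Primrec.decode.comp
      (Primrec.fst.comp (Primrec.unpair.comp Primrec.snd))) ?_
    refine Primrec.ite (Primrec.eq.comp ?_ (Primrec.const true))
      (Primrec.option_some.comp Primrec.snd) (Primrec.const none)
    exact hS.comp (Primrec.snd.pair (Primrec.fst.comp Primrec.fst))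
      (Primrec.snd.comp (Primrec.unpair.comp (Primrec.snd.comp Primrec.fst)))
  let a : ℕ → ℕ → List (List Bool) := fun i s => (List.range s).filterMap (e i)
  have hmem : ∀ i s X, X ∈ toClass (a i s) ↔ ∃ t < s, ∃ σ, e i t = some σ ∧ X ∈ cone σ := by
    intro i s X
    rw [mem_toClass]
    simp only [a, List.mem_filterMap, List.mem_range]
    constructor
    · rintro ⟨σ, ⟨t, ht, h⟩, hX⟩
      exact ⟨t, ht, σ, h, hX⟩
    · rintro ⟨t, ht, σ, h, hX⟩
      exact ⟨σ, ⟨t, ht, h⟩, hX⟩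
  refine ⟨a, ?_, fun i s t hst => ?_, fun i => ?_, fun i => ?_⟩
  · exact Primrec.listFilterMap (Primrec.list_range.comp Primrec.snd)
      (hep.comp (Primrec.fst.comp Primrec.fst) Primrec.snd)
  · refine le_iff.2 fun X hX => ?_
    obtain ⟨r, hr, h⟩ := (hmem i s X).1 hX
    exact (hmem i t X).2 ⟨r, hr.trans_le hst, h⟩
  · refine Set.eq_empty_of_forall_notMem fun X hX => ?_
    obtain ⟨r, hr, -⟩ := (hmem i 0 X).1 hX
    exact absurd hr (Nat.not_lt_zero r)
  · ext X
    refine (hψ X i).trans (Iff.trans ?_ Set.mem_iUnion.symm)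
    constructor
    · rintro ⟨n, hn⟩
      obtain ⟨s, hs⟩ := (hWS _).1 hn
      refine ⟨Nat.pair (Encodable.encode (initSeg X n)) s + 1, (hmem _ _ _).2
        ⟨_, Nat.lt_succ_self _, initSeg X n, (he _ _ _).2 ⟨?_, ?_⟩, mem_cone_initSeg X n⟩⟩
      · rw [Nat.unpair_pair, Encodable.encodek]
      · rwa [Nat.unpair_pair]
    · rintro ⟨s, hs⟩
      obtain ⟨t, -, σ, h, hX⟩ := (hmem _ _ _).1 hs
      refine ⟨σ.length, ?_⟩
      rw [show initSeg X σ.length = σ from hX]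
      exact (hWS _).2 ⟨_, ((he _ _ _).1 h).2⟩

/-- The approximation system of an effectively enumerated family containing all odd classes. -/
theorem exists_approxSystem {ψ : ℕ → Set (ℕ → Bool)} (h : IsSigma01 fun X e => X ∈ ψ e)
    (hodd : ∀ c : ClopenCode, Good c → ∃ i, ψ i = c.toClass) :
    ∃ S : ApproxSystem ClopenCode, S.bot.toClass = ∅ ∧ S.good = Good ∧ Primrec₂ S.a ∧
      ∀ i, ψ i = ⋃ s, (S.a i s).toClass := by
  obtain ⟨a, ha, hmono, ha0, hψ⟩ := exists_primrec_approximation h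
  have hbot : toClass [] = ∅ := Set.eq_empty_of_forall_notMem fun X hX => by
    simpa using mem_toClass.1 hX
  refine ⟨{
    bot := ([] : List (List Bool))
    good := Good
    a := a
    bot_le := fun c => le_iff.2 (hbot.le.trans (Set.empty_subset _))
    a_zero := fun i => le_iff.2 ((ha0 i).le.trans (Set.empty_subset _))
    mono := hmono
    not_good_bot := fun c hc hle => ?_
    dense := fun d e hde h T => exists_good_between hde h T
    good_mem := fun c hc => ?_
    nontrivial := ⟨([[]] : List (List Bool)), fun hle => ?_⟩ }, hbot, rfl, ha, hψ⟩
  · have hpos : 0 < List.length c := hc.1.pos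
    have hmem := List.getElem_mem hpos
    exact hbot.le (le_iff.1 hle (mem_toClass.2 ⟨_, hmem, zeroExt_mem _⟩))
  · obtain ⟨i, hi⟩ := hodd c hc
    refine ⟨i, cofinal_of_iUnion_eq (fun _ _ _ => le_rfl) (hmono i) ?_⟩
    rw [← hψ, hi, Set.iUnion_const]
  · exact hbot.le (le_iff.1 hle (mem_toClass.2 ⟨[], by simp, zeroExt_mem []⟩))

end ClopenCode

/-! ### The Friedberg numbering -/

open ClopenCode in
theorem exists_friedbergNumbering {F : Set (Set (ℕ → Bool))} (hF : IsEffectivelyEnumerable F)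
    (hodd : {U | ∃ O ∈ oddOptimalCoverings, U = openClass O} ⊆ F) :
    ∃ ψ : ℕ → Set (ℕ → Bool), IsFriedbergNumbering ψ F := by
  obtain ⟨ψ, hψF, hψ⟩ := hF
  obtain ⟨S, hbot, hgood, ha, hψa⟩ := exists_approxSystem hψ fun c hc => by
    have : c.toClass ∈ F := hodd hc.toClass_mem
    rwa [← hψF] at this
  obtain ⟨g, hg, hg1, hg2, hg3, hg4⟩ := S.exists_injective primrecRel_le
    (hgood ▸ primrecPred_good) ha
  let θ : ℕ → Set (ℕ → Bool) := fun x => ⋃ s, (g x s).toClass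
  have hθψ : ∀ {x i}, Cofinal (g x) (S.a i) → θ x = ψ i := fun h =>
    (iUnion_eq_of_cofinal h).trans (hψa _).symm
  have hθF : ∀ x, θ x ∈ F := fun x => by
    obtain ⟨i, hi⟩ := hg1 x
    rw [hθψ hi, ← hψF]
    exact ⟨i, rfl⟩
  have hθne : ∀ x, θ x ≠ ∅ := fun x he => by
    obtain ⟨s, hs⟩ := hg2 x
    refine hs (le_iff.2 ?_)
    rw [hbot, ← he]
    exact Set.subset_iUnion (fun s => (g x s).toClass) s
  have hθsurj : ∀ U ∈ F, U ≠ ∅ → ∃ x, θ x = U := by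
    intro U hU hne
    rw [← hψF] at hU
    obtain ⟨i, rfl⟩ := hU
    obtain ⟨x, hx⟩ := hg3 i (by
      by_contra hcon
      push Not at hcon
      refine hne ?_
      rw [hψa, Set.iUnion_eq_empty]
      exact fun s => Set.subset_eq_empty (le_iff.1 (hcon s)) hbot)
    exact ⟨x, hθψ hx⟩
  have hθinj : Function.Injective θ := by
    intro x y hxy
    obtain ⟨i, hi⟩ := hg1 x
    obtain ⟨j, hj⟩ := hg1 y
    refine hg4 x y (hi.trans (Cofinal.trans ?_ hj.symm))
    refine cofinal_of_iUnion_eq (S.mono i) (S.mono j) ?_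
    rw [← hψa, ← hψa, ← hθψ hi, ← hθψ hj, hxy]
  -- Only slots that have left bottom are numbered, so `θ` lists exactly the nonempty members; the
  -- empty class, if present, receives index `0`.
  by_cases hE : ∅ ∈ F
  · let g' : ℕ → ℕ → ClopenCode := fun e s => Nat.casesOn e S.bot fun x => g x s
    have hg' : Computable₂ g' := Computable.nat_casesOn Computable.fst (Computable.const _)
      (hg.comp Computable.snd (Computable.snd.comp Computable.fst)).to₂
    have h0 : ⋃ s, (g' 0 s).toClass = ∅ := by
      rw [Set.iUnion_eq_empty]
      exact fun _ => hbot
    have hs : ∀ x, ⋃ s, (g' (x + 1) s).toClass = θ x := fun _ => rfl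
    refine ⟨fun e => ⋃ s, (g' e s).toClass, ⟨⟨?_, isSigma01_iUnion hg'⟩, ?_⟩⟩
    · apply Set.Subset.antisymm
      · rintro _ ⟨_ | x, rfl⟩
        · show ⋃ s, (g' 0 s).toClass ∈ F
          rwa [h0]
        · exact hθF x
      · intro U hU
        by_cases hne : U = ∅
        · exact ⟨0, h0.trans hne.symm⟩
        · obtain ⟨x, hx⟩ := hθsurj U hU hne
          exact ⟨x + 1, hx⟩
    · rintro (_ | x) (_ | y) hxy
      · rfl
      · exact (hθne y (hxy.symm.trans h0)).elim
      · exact (hθne x (hxy.trans h0)).elim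
      · rw [hθinj (hxy : θ x = θ y)]
  · refine ⟨θ, ⟨⟨?_, isSigma01_iUnion hg⟩, hθinj⟩⟩
    apply Set.Subset.antisymm
    · rintro _ ⟨x, rfl⟩
      exact hθF x
    · intro U hU
      exact hθsurj U hU fun h => hE (h ▸ hU)

end CantorNumbering

theorem mainTheorem3 (F : Set (Set (ℕ → Bool)))
    (hF : CantorNumbering.IsEffectivelyEnumerable F)
    (hodd : {U | ∃ O ∈ CantorNumbering.oddOptimalCoverings,
      U = CantorNumbering.openClass O} ⊆ F) :
    ∃ ψ : ℕ → Set (ℕ → Bool), CantorNumbering.IsFriedbergNumbering ψ F :=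
  CantorNumbering.exists_friedbergNumbering hF hodd
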